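/- **Theorem.** Let $\mathcal C$ be the set of twice differentiable functions $\phi:\mathbb R\to\mathbb R$ with $\|\phi'\|_\infty<\infty$ and $\|\phi''\|_\infty<\infty$. Let $\mathcal M$ be the set of nonincreasing, left-continuous functions $a:[0,1]\to[0,1]$ (functional order parameters). For $\phi\in\mathcal C$ and a step function $a\in\mathcal M$, let $F_{\phi,a}$ be the solution of $$\partial_tF(x,t)=\tfrac12\left(\partial_{xx}F(x,t)+a(t)\,(\partial_xF(x,t))^2\right),\qquad F(x,0)=\phi(x),$$ on $\mathbb R\times[0,1]$; that is, $F$ is continuous on $\mathbb R\times[0,1]$, twice differentiable in $x$ for $t>0$ with $\partial_xF$ bounded, and the equation holds for all $x\in\mathbb R$ and $t\in(0,1]$, where $\partial_t$ is the derivative from the left. For general $a\in\mathcal M$, $F_{\phi,a}(x,t)$ is the limit of $F_{\phi,b_n}(x,t)$ for any step functions $b_n\in\mathcal M$ with $\int_0^1|b_n(t)-a(t)|\,dt\to0$. The Parisi functional is $P_{\phi,x}(a)=F_{\phi,a}(x,1)$, $x\in\mathbb R$. Let $\phi_1,\phi_2\in\mathcal C$ be convex with $\phi_1\le\phi_2$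 on $\mathbb R$, and suppose that either 1. $\phi_1,\phi_2$ are nondecreasing and $\phi_1'\le\phi_2'$ on $\mathbb R$, or 2. $\phi_1,\phi_2$ are even and $\phi_1'\le\phi_2'$ on $[0,\infty)$. Let $a_1,a_2\in\mathcal M$ with $a_1\le a_2$. Then for all $\alpha\in[0,1]$ and $x\in\mathbb R$, with $\phi=\alpha\phi_1+(1-\alpha)\phi_2$ and $a=\alpha a_1+(1-\alpha)a_2$, the values $P_{\phi,x}(a)$, $P_{\phi_1,x}(a_1)$, $P_{\phi_2,x}(a_2)$ are well defined and $$P_{\phi,x}(a)\le\alpha P_{\phi_1,x}(a_1)+(1-\alpha)P_{\phi_2,x}(a_2).$$ -/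

import Mathlib

open Set Filter Topology

noncomputable section

/-- The class `𝒞` of admissible initial data: twice differentiable functions on `ℝ` whose first
and second derivatives are bounded. -/
structure IsAdmissible (φ : ℝ → ℝ) : Prop where
  differentiable : Differentiable ℝ φ
  differentiable_deriv : Differentiable ℝ (deriv φ)
  bounded_deriv : ∃ K : ℝ, ∀ x, |deriv φ x| ≤ K
  bounded_deriv_deriv : ∃ K : ℝ, ∀ x, |deriv (deriv φ) x| ≤ K

/-- Pairs of nondecreasing convex admissible functions with `φ₁ ≤ φ₂` and `φ₁' ≤ φ₂'` on `ℝ`. -/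
def monotonePairs : Set ((ℝ → ℝ) × (ℝ → ℝ)) :=
  {p | IsAdmissible p.1 ∧ IsAdmissible p.2 ∧
    Monotone p.1 ∧ Monotone p.2 ∧
    ConvexOn ℝ univ p.1 ∧ ConvexOn ℝ univ p.2 ∧
    (∀ x, p.1 x ≤ p.2 x) ∧ ∀ x, deriv p.1 x ≤ deriv p.2 x}

/-- Pairs of even convex admissible functions with `φ₁ ≤ φ₂` on `ℝ` and `φ₁' ≤ φ₂'` on `[0,∞)`. -/
def evenPairs : Set ((ℝ → ℝ) × (ℝ → ℝ)) :=
  {p | IsAdmissible p.1 ∧ IsAdmissible p.2 ∧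
    Function.Even p.1 ∧ Function.Even p.2 ∧
    ConvexOn ℝ univ p.1 ∧ ConvexOn ℝ univ p.2 ∧
    (∀ x, p.1 x ≤ p.2 x) ∧ ∀ x, 0 ≤ x → deriv p.1 x ≤ deriv p.2 x}

/-- The family `ℱ` of pairs of initial data. -/
def orderedPairs : Set ((ℝ → ℝ) × (ℝ → ℝ)) := monotonePairs ∪ evenPairs

/-- The space `ℳ` of functional order parameters: nonincreasing left-continuous functions from
`[0,1]` to `[0,1]`. Only the values on `[0,1]` matter. -/
structure IsOrderParameter (a : ℝ → ℝ) : Prop where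
  mapsTo : MapsTo a (Icc 0 1) (Icc 0 1)
  antitoneOn : AntitoneOn a (Icc 0 1)
  left_continuous : ∀ t ∈ Icc (0 : ℝ) 1, ContinuousWithinAt a (Icc 0 t) t

/-- A step-like order parameter: one that takes finitely many values on `[0,1]`. -/
structure IsStepOrderParameter (a : ℝ → ℝ) : Prop extends IsOrderParameter a where
  finite_image : (a '' Icc 0 1).Finite

/-- `F x t` is the (classical) solution on `ℝ × [0,1]` of the Parisi equation
`∂ₜF = (∂ₓₓF + a(t) (∂ₓF)²) / 2` with initial condition `F(·,0) = φ`: it is continuous up to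
`t = 0`, has bounded spatial gradient (without a growth condition solutions of parabolic equations
on the line are not unique), is twice differentiable in `x` for `t > 0`, and satisfies the equation
at every `x` and every `t ∈ (0,1]`. Since `a` is only left-continuous, `F` has a corner in time at
the jumps of `a`, and `∂ₜ` is the derivative from the left. -/
structure IsParisiPDESolution (φ a : ℝ → ℝ) (F : ℝ → ℝ → ℝ) : Prop where
  continuousOn : ContinuousOn (fun p : ℝ × ℝ => F p.1 p.2) (univ ×ˢ Icc 0 1)
  initial : ∀ x, F x 0 = φ x
  differentiable : ∀ t ∈ Ioc (0 : ℝ) 1, Differentiable ℝ (fun y => F y t)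
  differentiable_deriv : ∀ t ∈ Ioc (0 : ℝ) 1, Differentiable ℝ (deriv (fun y => F y t))
  bounded_gradient : ∃ L : ℝ, ∀ t ∈ Ioc (0 : ℝ) 1, ∀ x, |deriv (fun y => F y t) x| ≤ L
  equation : ∀ x, ∀ t ∈ Ioc (0 : ℝ) 1,
    HasDerivWithinAt (fun s => F x s)
      ((deriv (deriv (fun y => F y t)) x + a t * (deriv (fun y => F y t) x) ^ 2) / 2)
      (Icc 0 t) t

/-- The sequence `b` of step-like order parameters converges to `a` in `L¹[0,1]`, and `G n` solves
the Parisi equation with parameter `b n` and initial condition `φ`. -/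
structure IsStepApproximation (φ a : ℝ → ℝ) (b : ℕ → ℝ → ℝ) (G : ℕ → ℝ → ℝ → ℝ) : Prop where
  step : ∀ n, IsStepOrderParameter (b n)
  tendsto : Tendsto (fun n => ∫ t in (0 : ℝ)..1, |b n t - a t|) atTop (𝓝 0)
  solution : ∀ n, IsParisiPDESolution φ (b n) (G n)

/-- `v` is the value `F_{φ,a}(x,t)`, where `a ↦ F_{φ,a}(x,t)` is extended from step-like order
parameters to all order parameters by continuity in `L¹[0,1]`: step approximations of `a` exist,
and along each of them the solutions converge to `v` at `(x,t)`. -/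
def IsParisiSolutionValue (φ a : ℝ → ℝ) (x t v : ℝ) : Prop :=
  (∃ b G, IsStepApproximation φ a b G) ∧
    ∀ b G, IsStepApproximation φ a b G → Tendsto (fun n => G n x t) atTop (𝓝 v)

theorem IsParisiSolutionValue.unique {φ a : ℝ → ℝ} {x t v w : ℝ}
    (hv : IsParisiSolutionValue φ a x t v) (hw : IsParisiSolutionValue φ a x t w) : v = w := by
  obtain ⟨⟨b, G, h⟩, hv⟩ := hv
  exact tendsto_nhds_unique (hv b G h) (hw.2 b G h)

/-- `F_{φ,a}(x,t)`: the unique `v` with `IsParisiSolutionValue φ a x t v`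
(an arbitrary number if there is none). -/
def parisiSolution (φ a : ℝ → ℝ) (x t : ℝ) : ℝ :=
  Classical.epsilon (IsParisiSolutionValue φ a x t)

/-- The Parisi functional `P_{φ,x}(a) = F_{φ,a}(x,1)`. -/
def parisiFunctional (φ : ℝ → ℝ) (x : ℝ) (a : ℝ → ℝ) : ℝ := parisiSolution φ a x 1

/-- The Parisi functional `P_{φ,x}` is well defined at `a`. -/
def ParisiFunctionalDefined (φ : ℝ → ℝ) (x : ℝ) (a : ℝ → ℝ) : Prop :=
  IsParisiSolutionValue φ a x 1 (parisiFunctional φ x a)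

end

/-! For step parameters, αF₁ + (1-α)F₂ is a supersolution of the equation for the mixed data φ, a,
so comparison puts it above F. With pᵢ = ∂ₓFᵢ this rests on the identity α a₁p₁² + (1-α)a₂p₂² -
a(αp₁ + (1-α)p₂)² = α(1-α)[(a₂-a₁)(p₂²-p₁²) + a(p₂-p₁)²], whose right side is nonnegative as soon as
p₁² ≤ p₂².

The heart is therefore p₁² ≤ p₂² for t > 0 (`sq_deriv_le`). To avoid differentiating the equation,
gradients are compared through increments: with H = F₂ - F₁, the function H(y,t) - H(x,t) is shown
to be nonnegative on a region of pairs, x ≤ y in the monotone case and |x| ≤ y in the even case, on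
whose boundary it vanishes (`increment_le`). Convexity is preserved by the flow (`convexOn`);
together with monotonicity or evenness it makes p₁(x)² ≤ p₁(y)² on the region, so the source
(a₂-a₁)p₁² has the right sign. Comparison, convexity and increments all come from
`parabolic_min_principle`: both points move together, so second derivatives enter only along the
diagonal, and differences of squared gradients become bounded drifts.

Comparison also shows that solutions depend on the parameter in a Lipschitz way in L¹, with a
constant depending only on the Lipschitz constant of φ (`abs_sub_le_integral`); hence the extension
to general parameters is well defined. Solutions for positive step parameters are built by the
Cole–Hopf transform, one interval of constancy at a time. The approximations `stepApprox` are
positive, order preserving and affine in a, so the inequality for step parameters passes to the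
limit. -/

/-! ### Minimum principle in doubled space variables -/

theorem deriv_nonneg_of_isLocalMin {f g : ℝ → ℝ} {c : ℝ} (hf : ∀ s, HasDerivAt f (g s) s)
    (hg : HasDerivAt g c 0) (hmin : IsLocalMin f 0) : 0 ≤ c := by
  by_contra! hc
  have hfg : deriv f = g := funext fun s => (hf s).deriv
  -- A negative second derivative would make 0 a local maximum as well, hence f locally constant,
  -- which forces c = 0.
  have hmax : IsLocalMax f 0 := by
    refine isLocalMax_of_deriv_deriv_neg ?_ hmin.deriv_eq_zero (hf 0).continuousAt
    rw [hfg, hg.deriv]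
    exact hc
  have hconst : f =ᶠ[𝓝 0] fun _ => f 0 := by
    filter_upwards [hmin, hmax] with s h1 h2 using le_antisymm h2 h1
  have hzero : g =ᶠ[𝓝 0] fun _ => 0 := by
    rw [← hfg]
    simpa using hconst.deriv
  have := hzero.deriv_eq
  rw [hg.deriv] at this
  simp at this
  exact hc.ne this

theorem hasDerivWithinAt_nonpos_of_right_endpoint_min {f : ℝ → ℝ} {c t : ℝ} (ht : 0 < t)
    (hf : HasDerivWithinAt f c (Icc 0 t) t) (hmin : ∀ s ∈ Icc 0 t, f t ≤ f s) : c ≤ 0 := by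
  have h := hasDerivWithinAt_iff_tendsto_slope.1 hf
  have hne : (𝓝[Icc 0 t \ {t}] t).NeBot := by
    rw [Icc_sdiff_right]
    exact right_nhdsWithin_Ico_neBot ht
  refine le_of_tendsto h ?_
  filter_upwards [self_mem_nhdsWithin] with s hs
  rw [slope_def_field]
  have h1 : s < t := lt_of_le_of_ne hs.1.2 hs.2
  exact div_nonpos_of_nonneg_of_nonpos (by linarith [hmin s hs.1]) (by linarith)

/-- A minimum principle for functions of two space variables, in which the second-order part of
the operator only acts along the diagonal direction. -/
theorem parabolic_min_principle {D : Set (ℝ × ℝ)} (hD : IsClosed D) {W : ℝ × ℝ → ℝ → ℝ}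
    (hcont : ContinuousOn (fun q : (ℝ × ℝ) × ℝ => W q.1 q.2) (D ×ˢ Icc 0 1))
    {C K : ℝ} (hK : 0 ≤ K)
    (hgrow : ∀ z ∈ D, ∀ t ∈ Icc (0 : ℝ) 1, -(C * (1 + |z.1| + |z.2|)) ≤ W z t)
    (hinit : ∀ z ∈ D, 0 ≤ W z 0)
    (hbdry : ∀ z ∈ D, z ∉ interior D → ∀ t ∈ Icc (0 : ℝ) 1, 0 ≤ W z t)
    (hint : ∀ z ∈ interior D, ∀ t ∈ Ioc (0 : ℝ) 1, ∃ (wt wx wy w2 : ℝ) (g : ℝ → ℝ),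
      HasDerivWithinAt (W z) wt (Icc 0 t) t ∧
      HasDerivAt (fun s => W (s, z.2) t) wx z.1 ∧
      HasDerivAt (fun s => W (z.1, s) t) wy z.2 ∧
      (∀ s, HasDerivAt (fun s => W (z.1 + s, z.2 + s) t) (g s) s) ∧
      HasDerivAt g w2 0 ∧ w2 / 2 - K * (|wx| + |wy|) ≤ wt) :
    ∀ z ∈ D, ∀ t ∈ Icc (0 : ℝ) 1, 0 ≤ W z t := by
  intro z₀ hz₀ t₀ ht₀
  by_contra! hneg
  -- At a negative minimum of W + ε e^{λt} Q, with e = ε e^{λt}, one gets |wx| + |wy| ≤ eQ, w2 ≥ -4e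
  -- and wt ≤ -λeQ. The inequality for wt then gives λeQ ≤ KeQ + 2e, and 2e ≤ eQ, so λ = K + 2 is a
  -- contradiction. The constant 2 in Q serves both 2 ≤ Q and 2|x| + 2|y| ≤ Q.
  set lam := K + 2 with hlam
  let Q : ℝ × ℝ → ℝ := fun z => 2 + z.1 ^ 2 + z.2 ^ 2
  have hQ : ∀ z, 2 ≤ Q z := fun z => by simp only [Q]; nlinarith [sq_nonneg z.1, sq_nonneg z.2]
  obtain ⟨ε, hε, hεneg⟩ : ∃ ε > 0, W z₀ t₀ + ε * Real.exp (lam * t₀) * Q z₀ < 0 := by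
    have hp : 0 < Real.exp (lam * t₀) * Q z₀ :=
      mul_pos (Real.exp_pos _) (by linarith [hQ z₀])
    refine ⟨-W z₀ t₀ / 2 / (Real.exp (lam * t₀) * Q z₀), by
      apply div_pos <;> linarith, ?_⟩
    rw [mul_assoc, div_mul_cancel₀ _ hp.ne']
    linarith
  let V : (ℝ × ℝ) × ℝ → ℝ := fun q => W q.1 q.2 + ε * Real.exp (lam * q.2) * Q q.1
  have hVcont : ContinuousOn V (D ×ˢ Icc 0 1) := by
    apply hcont.add
    apply Continuous.continuousOn
    simp only [Q]
    fun_prop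
  -- The quadratic penalty beats the linear growth of W, so negative values of V occur only in a
  -- bounded set and a minimum is attained.
  have hlarge : ∃ R : ℝ, ∀ z ∈ D, ∀ t ∈ Icc (0 : ℝ) 1, R ≤ ‖z‖ → 0 ≤ V (z, t) := by
    refine ⟨3 * |C| / ε + 1, fun z hz t ht hR => ?_⟩
    have h1 : |z.1| ≤ ‖z‖ := norm_fst_le z
    have h2 : |z.2| ≤ ‖z‖ := norm_snd_le z
    have h3 : ‖z‖ ^ 2 ≤ z.1 ^ 2 + z.2 ^ 2 := by
      rw [Prod.norm_def]
      rcases max_cases ‖z.1‖ ‖z.2‖ with h | h <;> rw [h.1, Real.norm_eq_abs, sq_abs] <;>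
        nlinarith [sq_nonneg z.1, sq_nonneg z.2]
    have h4 : 3 * |C| + ε ≤ ε * ‖z‖ := by
      have := mul_le_mul_of_nonneg_left hR hε.le
      rwa [mul_add, mul_div_cancel₀ _ hε.ne', mul_one] at this
    have h5 : 1 ≤ ‖z‖ := le_trans (by
      have : 0 ≤ 3 * |C| / ε := by positivity
      linarith) hR
    have h6 : 1 ≤ Real.exp (lam * t) := Real.one_le_exp (mul_nonneg (by linarith) ht.1)
    have h7 : C * (1 + |z.1| + |z.2|) ≤ |C| * (3 * ‖z‖) := by
      calc C * (1 + |z.1| + |z.2|) ≤ |C| * (1 + |z.1| + |z.2|) := by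
            gcongr
            exact le_abs_self C
        _ ≤ _ := by gcongr; linarith
    have h8 : |C| * (3 * ‖z‖) ≤ ε * ‖z‖ ^ 2 := by nlinarith
    have h9 : ε * ‖z‖ ^ 2 ≤ ε * Real.exp (lam * t) * Q z := by
      rw [mul_assoc]
      refine mul_le_mul_of_nonneg_left ?_ hε.le
      have : ‖z‖ ^ 2 ≤ Q z := by simp only [Q]; linarith
      nlinarith [hQ z]
    have := hgrow z hz t ht
    simp only [V]
    linarith
  obtain ⟨R, hR⟩ := hlarge
  have hVneg : V (z₀, t₀) < 0 := hεneg
  have hcomp : IsCompact ((D ∩ Metric.closedBall 0 R) ×ˢ Icc (0 : ℝ) 1) :=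
    ((isCompact_closedBall 0 R).inter_left hD).prod isCompact_Icc
  have hz₀R : z₀ ∈ Metric.closedBall (0 : ℝ × ℝ) R := by
    rw [mem_closedBall_zero_iff]
    by_contra! h
    exact absurd (hR z₀ hz₀ t₀ ht₀ h.le) (not_le.2 hVneg)
  obtain ⟨⟨z, t⟩, ⟨⟨hzD, -⟩, ht⟩, hzmin⟩ := hcomp.exists_isMinOn
    ⟨(z₀, t₀), ⟨hz₀, hz₀R⟩, ht₀⟩ (hVcont.mono (prod_mono inter_subset_left le_rfl))
  have hVz : V (z, t) < 0 := lt_of_le_of_lt (hzmin ⟨⟨hz₀, hz₀R⟩, ht₀⟩) hVneg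
  have hmin : ∀ z' ∈ D, ∀ t' ∈ Icc (0 : ℝ) 1, V (z, t) ≤ V (z', t') := by
    intro z' hz' t' ht'
    by_cases h : z' ∈ Metric.closedBall (0 : ℝ × ℝ) R
    · exact hzmin ⟨⟨hz', h⟩, ht'⟩
    · rw [mem_closedBall_zero_iff, not_le] at h
      exact hVz.le.trans (hR z' hz' t' ht' h.le)
  have hWz : W z t < 0 := by
    have : 0 ≤ ε * Real.exp (lam * t) * Q z :=
      mul_nonneg (by positivity) (by linarith [hQ z])
    simp only [V] at hVz
    linarith
  have hzint : z ∈ interior D := by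
    by_contra h
    exact absurd (hbdry z hzD h t ht) (not_le.2 hWz)
  have htpos : 0 < t := by
    rcases ht.1.eq_or_lt with h | h
    · subst h
      exact absurd (hinit z hzD) (not_le.2 hWz)
    · exact h
  obtain ⟨wt, wx, wy, w2, g, hwt, hwx, hwy, hg, hw2, hineq⟩ := hint z hzint t ⟨htpos, ht.2⟩
  set e := ε * Real.exp (lam * t) with he
  have hepos : 0 < e := by positivity
  have hDn : D ∈ 𝓝 z := mem_interior_iff_mem_nhds.1 hzint
  have hminx : IsLocalMin (fun s => V ((s, z.2), t)) z.1 := by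
    have hc : ContinuousAt (fun s : ℝ => (s, z.2)) z.1 := by fun_prop
    filter_upwards [hc.preimage_mem_nhds (t := D) hDn] with s hs using hmin _ hs _ ht
  have hminy : IsLocalMin (fun s => V ((z.1, s), t)) z.2 := by
    have hc : ContinuousAt (fun s : ℝ => (z.1, s)) z.2 := by fun_prop
    filter_upwards [hc.preimage_mem_nhds (t := D) hDn] with s hs using hmin _ hs _ ht
  have hmind : IsLocalMin (fun s => V ((z.1 + s, z.2 + s), t)) 0 := by
    have hc : ContinuousAt (fun s : ℝ => (z.1 + s, z.2 + s)) 0 := by fun_prop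
    have hD' : D ∈ 𝓝 (z.1 + (0 : ℝ), z.2 + (0 : ℝ)) := by simpa using hDn
    filter_upwards [hc.preimage_mem_nhds hD'] with s hs
    simpa using hmin _ hs _ ht
  have hxeq : wx = -(e * (2 * z.1)) := by
    have h : HasDerivAt (fun s => V ((s, z.2), t)) (wx + e * (2 * z.1)) z.1 := by
      have h1 : HasDerivAt (fun s => e * (2 + s ^ 2 + z.2 ^ 2)) (e * (2 * z.1)) z.1 := by
        simpa using (((hasDerivAt_pow 2 z.1).const_add 2).add_const (z.2 ^ 2)).const_mul e
      exact hwx.add h1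
    linarith [hminx.hasDerivAt_eq_zero h]
  have hyeq : wy = -(e * (2 * z.2)) := by
    have h : HasDerivAt (fun s => V ((z.1, s), t)) (wy + e * (2 * z.2)) z.2 := by
      have h1 : HasDerivAt (fun s => e * (2 + z.1 ^ 2 + s ^ 2)) (e * (2 * z.2)) z.2 := by
        simpa using ((hasDerivAt_pow 2 z.2).const_add (2 + z.1 ^ 2)).const_mul e
      exact hwy.add h1
    linarith [hminy.hasDerivAt_eq_zero h]
  have hw2' : 0 ≤ w2 + e * 4 := by
    refine deriv_nonneg_of_isLocalMin (f := fun s => V ((z.1 + s, z.2 + s), t))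
      (g := fun s => g s + e * (2 * (z.1 + s) + 2 * (z.2 + s))) (fun s => ?_) ?_ hmind
    · have h1 : HasDerivAt (fun s => e * (2 + (z.1 + s) ^ 2 + (z.2 + s) ^ 2))
          (e * (2 * (z.1 + s) + 2 * (z.2 + s))) s := by
        have a1 := ((hasDerivAt_id s).const_add z.1).pow 2
        have a2 := ((hasDerivAt_id s).const_add z.2).pow 2
        have := ((a1.const_add 2).add a2).const_mul e
        simpa using this
      exact (hg s).add h1
    · have a1 := ((hasDerivAt_id (0 : ℝ)).const_add z.1).const_mul 2
      have a2 := ((hasDerivAt_id (0 : ℝ)).const_add z.2).const_mul 2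
      have h1 : HasDerivAt (fun s => e * (2 * (z.1 + s) + 2 * (z.2 + s))) (e * 4) 0 := by
        exact ((a1.add a2).const_mul e).congr_deriv (by ring)
      exact hw2.add h1
  have ht' : wt + lam * e * Q z ≤ 0 := by
    refine hasDerivWithinAt_nonpos_of_right_endpoint_min (f := fun s => V (z, s)) htpos ?_
      (fun s hs => hmin z hzD s ⟨hs.1, hs.2.trans ht.2⟩)
    have h1 : HasDerivAt (fun s => ε * Real.exp (lam * s) * Q z) (lam * e * Q z) t := by
      have := ((((hasDerivAt_id t).const_mul lam).exp).const_mul ε).mul_const (Q z)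
      refine this.congr_deriv ?_
      rw [he]
      simp only [id]
      ring
    exact hwt.add h1.hasDerivWithinAt
  have hx1 : |wx| = e * (2 * |z.1|) := by
    rw [hxeq, abs_neg, abs_mul, abs_of_pos hepos, abs_mul, abs_two]
  have hy1 : |wy| = e * (2 * |z.2|) := by
    rw [hyeq, abs_neg, abs_mul, abs_of_pos hepos, abs_mul, abs_two]
  have hx2 : 2 * |z.1| + 2 * |z.2| ≤ Q z := by
    simp only [Q]
    nlinarith [sq_abs z.1, sq_abs z.2, sq_nonneg (|z.1| - 1), sq_nonneg (|z.2| - 1)]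
  have h1 : K * (|wx| + |wy|) ≤ K * (e * Q z) := by
    rw [hx1, hy1, ← mul_add]
    gcongr
  have h2 : e * 2 ≤ e * Q z := by gcongr; exact hQ z
  have h3 : 0 < e * Q z := mul_pos hepos (by linarith [hQ z])
  have h4 : lam * e * Q z = K * (e * Q z) + 2 * (e * Q z) := by rw [hlam]; ring
  linarith

/-! ### Sub- and supersolutions and their comparison -/

theorem HasDerivAt.comp_const_add_zero {f : ℝ → ℝ} {c x : ℝ} (h : HasDerivAt f c x) :
    HasDerivAt (fun s => f (x + s)) c 0 :=
  HasDerivAt.comp_const_add x 0 (by simpa using h)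

/-- `F` is continuous on `ℝ × [0,1]` and of linear growth, and for `t > 0` it has spatial
derivatives `p` and `q`, the first of which is bounded, and a left time derivative `r`. -/
structure IsRegularFlow (F p q r : ℝ → ℝ → ℝ) : Prop where
  continuousOn : ContinuousOn (fun z : ℝ × ℝ => F z.1 z.2) (univ ×ˢ Icc 0 1)
  growth : ∃ C : ℝ, ∀ x, ∀ t ∈ Icc (0 : ℝ) 1, |F x t| ≤ C * (1 + |x|)
  bounded : ∃ L : ℝ, ∀ x, ∀ t ∈ Ioc (0 : ℝ) 1, |p x t| ≤ L
  hasDerivAt : ∀ x, ∀ t ∈ Ioc (0 : ℝ) 1, HasDerivAt (fun y => F y t) (p x t) x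
  hasDerivAt_deriv : ∀ x, ∀ t ∈ Ioc (0 : ℝ) 1, HasDerivAt (fun y => p y t) (q x t) x
  hasDerivWithinAt : ∀ x, ∀ t ∈ Ioc (0 : ℝ) 1, HasDerivWithinAt (fun s => F x s) (r x t) (Icc 0 t) t

namespace IsRegularFlow

variable {F G p q r p' q' r' : ℝ → ℝ → ℝ}

theorem const_mul (hF : IsRegularFlow F p q r) (c : ℝ) :
    IsRegularFlow (fun x t => c * F x t) (fun x t => c * p x t) (fun x t => c * q x t)
      (fun x t => c * r x t) where
  continuousOn := hF.continuousOn.const_mul c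
  growth := by
    obtain ⟨C, hC⟩ := hF.growth
    refine ⟨|c| * C, fun x t ht => ?_⟩
    rw [abs_mul, mul_assoc]
    exact mul_le_mul_of_nonneg_left (hC x t ht) (abs_nonneg c)
  bounded := by
    obtain ⟨L, hL⟩ := hF.bounded
    refine ⟨|c| * L, fun x t ht => ?_⟩
    rw [abs_mul]
    exact mul_le_mul_of_nonneg_left (hL x t ht) (abs_nonneg c)
  hasDerivAt x t ht := (hF.hasDerivAt x t ht).const_mul c
  hasDerivAt_deriv x t ht := (hF.hasDerivAt_deriv x t ht).const_mul c
  hasDerivWithinAt x t ht := (hF.hasDerivWithinAt x t ht).const_mul c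

theorem add (hF : IsRegularFlow F p q r) (hG : IsRegularFlow G p' q' r') :
    IsRegularFlow (fun x t => F x t + G x t) (fun x t => p x t + p' x t)
      (fun x t => q x t + q' x t) (fun x t => r x t + r' x t) where
  continuousOn := hF.continuousOn.add hG.continuousOn
  growth := by
    obtain ⟨C, hC⟩ := hF.growth
    obtain ⟨C', hC'⟩ := hG.growth
    refine ⟨C + C', fun x t ht => (abs_add_le _ _).trans ?_⟩
    rw [add_mul]
    exact add_le_add (hC x t ht) (hC' x t ht)
  bounded := by
    obtain ⟨C, hC⟩ := hF.bounded
    obtain ⟨C', hC'⟩ := hG.bounded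
    exact ⟨C + C', fun x t ht => (abs_add_le _ _).trans (add_le_add (hC x t ht) (hC' x t ht))⟩
  hasDerivAt x t ht := (hF.hasDerivAt x t ht).add (hG.hasDerivAt x t ht)
  hasDerivAt_deriv x t ht := (hF.hasDerivAt_deriv x t ht).add (hG.hasDerivAt_deriv x t ht)
  hasDerivWithinAt x t ht := (hF.hasDerivWithinAt x t ht).add (hG.hasDerivWithinAt x t ht)

/-- Added to a solution, a function of time alone gives a supersolution with a prescribed margin and
leaves the spatial derivatives unchanged. -/
theorem of_time {f f' : ℝ → ℝ} (hf : ContinuousOn f (Icc 0 1))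
    (hf' : ∀ t ∈ Ioc (0 : ℝ) 1, HasDerivWithinAt f (f' t) (Icc 0 t) t) :
    IsRegularFlow (fun _ t => f t) (fun _ _ => 0) (fun _ _ => 0) (fun _ t => f' t) where
  continuousOn := hf.comp continuousOn_snd fun _ hz => hz.2
  growth := by
    obtain ⟨C, hC⟩ := isCompact_Icc.exists_bound_of_continuousOn hf
    refine ⟨|C|, fun x t ht => (hC t ht).trans ((le_abs_self C).trans ?_)⟩
    nlinarith [abs_nonneg x, abs_nonneg C]
  bounded := ⟨0, by simp⟩
  hasDerivAt x t _ := hasDerivAt_const x (f t)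
  hasDerivAt_deriv x _ _ := hasDerivAt_const x 0
  hasDerivWithinAt _ t ht := hf' t ht

/-- The comparison principle: a subsolution of the Parisi equation stays below a supersolution. -/
theorem le_of_subsolution_of_supersolution {a : ℝ → ℝ} (hF : IsRegularFlow F p q r)
    (hG : IsRegularFlow G p' q' r') (ha : ∀ t ∈ Ioc (0 : ℝ) 1, a t ∈ Icc (0 : ℝ) 1)
    (hsub : ∀ x, ∀ t ∈ Ioc (0 : ℝ) 1, r x t ≤ (q x t + a t * p x t ^ 2) / 2)
    (hsuper : ∀ x, ∀ t ∈ Ioc (0 : ℝ) 1, (q' x t + a t * p' x t ^ 2) / 2 ≤ r' x t)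
    (hinit : ∀ x, F x 0 ≤ G x 0) {x t : ℝ} (ht : t ∈ Icc (0 : ℝ) 1) : F x t ≤ G x t := by
  obtain ⟨C, hC⟩ := hF.growth
  obtain ⟨C', hC'⟩ := hG.growth
  obtain ⟨L, hL⟩ := hF.bounded
  obtain ⟨L', hL'⟩ := hG.bounded
  have hLpos : 0 ≤ L := (abs_nonneg _).trans (hL 0 1 (by simp))
  have hLpos' : 0 ≤ L' := (abs_nonneg _).trans (hL' 0 1 (by simp))
  have hCpos : 0 ≤ C + C' := by
    have h1 := (abs_nonneg _).trans (hC 0 1 (by simp))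
    have h2 := (abs_nonneg _).trans (hC' 0 1 (by simp))
    simp at h1 h2
    linarith
  -- The second space variable is a dummy here.
  suffices h : 0 ≤ (fun (z : ℝ × ℝ) t => G z.1 t - F z.1 t) (x, 0) t from sub_nonneg.1 h
  refine parabolic_min_principle (D := univ) (W := fun z t => G z.1 t - F z.1 t) isClosed_univ
    (C := C + C') (K := L + L')
    ?_ (by positivity) (fun z _ t ht => ?_) (fun z _ => sub_nonneg.2 (hinit z.1))
    (by simp) (fun z _ t ht => ?_) _ (mem_univ _) t ht
  · have hc : ContinuousOn (fun q : (ℝ × ℝ) × ℝ => (q.1.1, q.2)) (univ ×ˢ Icc 0 1) := by fun_prop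
    have hm : MapsTo (fun q : (ℝ × ℝ) × ℝ => (q.1.1, q.2)) (univ ×ˢ Icc 0 1)
      (univ ×ˢ Icc (0 : ℝ) 1) := fun q hq => ⟨mem_univ _, hq.2⟩
    exact (hG.continuousOn.comp hc hm).sub (hF.continuousOn.comp hc hm)
  · have h1 := (abs_le.1 (hC z.1 t ht)).2
    have h2 := (abs_le.1 (hC' z.1 t ht)).1
    have h3 : 0 ≤ (C + C') * |z.2| := mul_nonneg hCpos (abs_nonneg _)
    linarith
  · refine ⟨r' z.1 t - r z.1 t, p' z.1 t - p z.1 t, 0, q' z.1 t - q z.1 t,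
      fun s => p' (z.1 + s) t - p (z.1 + s) t,
      (hG.hasDerivWithinAt _ t ht).sub (hF.hasDerivWithinAt _ t ht),
      (hG.hasDerivAt _ t ht).sub (hF.hasDerivAt _ t ht), hasDerivAt_const z.2 (G z.1 t - F z.1 t),
      fun s => ((hG.hasDerivAt _ t ht).comp_const_add z.1 s).sub
        ((hF.hasDerivAt _ t ht).comp_const_add z.1 s), ?_, ?_⟩
    · exact (hG.hasDerivAt_deriv z.1 t ht).comp_const_add_zero.sub
        (hF.hasDerivAt_deriv z.1 t ht).comp_const_add_zero
    · have h1 := hsub z.1 t ht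
      have h2 := hsuper z.1 t ht
      have h3 : |p z.1 t + p' z.1 t| ≤ L + L' :=
        (abs_add_le _ _).trans (add_le_add (hL _ t ht) (hL' _ t ht))
      -- The factorization p'² - p² = (p + p')(p' - p) turns the nonlinearity into a drift bounded
      -- by L + L', since 0 ≤ a ≤ 1.
      have h4 : |a t * ((p z.1 t + p' z.1 t) * (p' z.1 t - p z.1 t))| ≤
          1 * ((L + L') * |p' z.1 t - p z.1 t|) := by
        rw [abs_mul, abs_mul]
        gcongr
        rw [abs_of_nonneg (ha t ht).1]
        exact (ha t ht).2
      have h5 := (abs_le.1 h4).1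
      have h6 : 0 ≤ (L + L') * |p' z.1 t - p z.1 t| := by positivity
      rw [abs_zero, add_zero]
      nlinarith

end IsRegularFlow

/-! ### Stability, symmetry and Lipschitz bounds for Parisi solutions -/

theorem LipschitzWith.le_add_mul_abs {φ : ℝ → ℝ} {K : NNReal} (hφ : LipschitzWith K φ)
    (x y : ℝ) : φ x ≤ φ y + K * |x - y| := by
  have := hφ.dist_le_mul x y
  rw [Real.dist_eq, Real.dist_eq] at this
  linarith [le_abs_self (φ x - φ y)]

theorem IsAdmissible.exists_lipschitzWith {φ : ℝ → ℝ} (hφ : IsAdmissible φ) :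
    ∃ K, LipschitzWith K φ := by
  obtain ⟨K, hK⟩ := hφ.bounded_deriv
  refine ⟨K.toNNReal, lipschitzWith_of_nnnorm_deriv_le hφ.differentiable fun x => ?_⟩
  rw [← NNReal.coe_le_coe, coe_nnnorm]
  exact (hK x).trans (Real.le_coe_toNNReal K)

theorem IsOrderParameter.intervalIntegrable {a : ℝ → ℝ} (ha : IsOrderParameter a) :
    IntervalIntegrable a MeasureTheory.volume 0 1 := by
  apply AntitoneOn.intervalIntegrable
  rw [uIcc_of_le zero_le_one]
  exact ha.antitoneOn

namespace IsParisiPDESolution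

variable {φ ψ a b : ℝ → ℝ} {F G : ℝ → ℝ → ℝ} {K K' : NNReal}

theorem isRegularFlow (hφ : LipschitzWith K φ) (hF : IsParisiPDESolution φ a F) :
    IsRegularFlow F (fun x t => deriv (fun y => F y t) x)
      (fun x t => deriv (deriv (fun y => F y t)) x)
      (fun x t => (deriv (deriv (fun y => F y t)) x + a t * (deriv (fun y => F y t) x) ^ 2) / 2) where
  continuousOn := hF.continuousOn
  growth := by
    obtain ⟨L, hL⟩ := hF.bounded_gradient
    have hc : ContinuousOn (fun t => F 0 t) (Icc 0 1) :=
      hF.continuousOn.comp (f := fun t => ((0 : ℝ), t)) (by fun_prop)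
        fun _ ht => ⟨mem_univ _, ht⟩
    obtain ⟨C, hC⟩ := isCompact_Icc.exists_bound_of_continuousOn hc
    have hC0 : 0 ≤ C := (norm_nonneg _).trans (hC 0 (by simp))
    have hL0 : 0 ≤ L := (abs_nonneg _).trans (hL 1 (by simp) 0)
    -- C bounds F(0,·) on [0,1]; L controls increments in x for t > 0, and K those of the initial
    -- datum at t = 0.
    refine ⟨C + (L + K), fun x t ht => ?_⟩
    have h1 : |F x t - F 0 t| ≤ (L + K) * |x| := by
      rcases ht.1.eq_or_lt with h | h
      · subst h
        have h1 := hφ.le_add_mul_abs x 0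
        have h2 := hφ.le_add_mul_abs 0 x
        rw [abs_sub_comm] at h2
        rw [sub_zero] at h1 h2
        rw [hF.initial, hF.initial, abs_le]
        have : 0 ≤ L * |x| := by positivity
        constructor <;> linarith
      · have h2 := Convex.norm_image_sub_le_of_norm_deriv_le (f := fun y => F y t) (x := 0) (y := x)
          (s := univ) (C := L) (fun y _ => hF.differentiable t ⟨h, ht.2⟩ y)
          (fun y _ => hL t ⟨h, ht.2⟩ y) convex_univ (mem_univ _) (mem_univ _)
        rw [sub_zero] at h2
        refine h2.trans ?_
        rw [Real.norm_eq_abs]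
        gcongr
        simp
    have h2 : |F 0 t| ≤ C := hC t ht
    have h3 : |F x t| ≤ |F x t - F 0 t| + |F 0 t| := by
      simpa using abs_add_le (F x t - F 0 t) (F 0 t)
    have h4 : 0 ≤ C * |x| := by positivity
    have h5 : 0 ≤ (K : ℝ) := K.2
    linarith
  bounded := by
    obtain ⟨L, hL⟩ := hF.bounded_gradient
    exact ⟨L, fun x t ht => hL t ht x⟩
  hasDerivAt x t ht := (hF.differentiable t ht x).hasDerivAt
  hasDerivAt_deriv x t ht := (hF.differentiable_deriv t ht x).hasDerivAt
  hasDerivWithinAt x t ht := hF.equation x t ht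

/-- Dependence of solutions on the initial condition and on the order parameter. -/
theorem le_add_integral (hφ : LipschitzWith K φ) (hψ : LipschitzWith K' ψ)
    (ha : IsOrderParameter a) (hb : IsOrderParameter b)
    (hF : IsParisiPDESolution φ a F) (hG : IsParisiPDESolution ψ b G) {M c : ℝ}
    (hM : ∀ t ∈ Ioc (0 : ℝ) 1, ∀ x, |deriv (fun y => G y t) x| ≤ M)
    (hc : ∀ x, φ x ≤ ψ x + c) {x t : ℝ} (ht : t ∈ Icc (0 : ℝ) 1) :
    F x t ≤ G x t + (c + M ^ 2 / 2 * ∫ s in (0 : ℝ)..t, |a s - b s|) := by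
  have hint : IntervalIntegrable (fun s => |a s - b s|) MeasureTheory.volume 0 1 :=
    (ha.intervalIntegrable.sub hb.intervalIntegrable).abs
  have hcont : ContinuousOn (fun t => c + M ^ 2 / 2 * ∫ s in (0 : ℝ)..t, |a s - b s|)
      (Icc 0 1) := by
    apply ContinuousOn.const_add
    apply ContinuousOn.const_mul
    have := intervalIntegral.continuousOn_primitive_interval' hint left_mem_uIcc
    rwa [uIcc_of_le zero_le_one] at this
  have hderiv : ∀ t ∈ Ioc (0 : ℝ) 1,
      HasDerivWithinAt (fun t => c + M ^ 2 / 2 * ∫ s in (0 : ℝ)..t, |a s - b s|)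
        (M ^ 2 / 2 * |a t - b t|) (Icc 0 t) t := by
    intro t ht
    refine (HasDerivWithinAt.const_mul _ ?_).const_add c
    have ht' : t ∈ Icc (0 : ℝ) 1 := ⟨ht.1.le, ht.2⟩
    have hnhds : 𝓝[Icc 0 t] t = 𝓝[≤] t := nhdsWithin_Icc_eq_nhdsLE ht.1
    -- Left-continuity of a and b yields the left derivative of the primitive at every t, not merely
    -- almost everywhere.
    have hcw : ContinuousWithinAt (fun s => |a s - b s|) (Iic t) t := by
      have := ((ha.left_continuous t ht').sub (hb.left_continuous t ht')).abs
      rwa [ContinuousWithinAt, hnhds] at this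
    have hint' : IntervalIntegrable (fun s => |a s - b s|) MeasureTheory.volume 0 t :=
      hint.mono_set (by
        rw [uIcc_of_le zero_le_one, uIcc_of_le ht.1.le]
        exact Icc_subset_Icc_right ht.2)
    have hmeas : StronglyMeasurableAtFilter (fun s => |a s - b s|) (𝓝[≤] t) :=
      ⟨Ioc 0 t, Ioc_mem_nhdsLE ht.1, hint'.1.aestronglyMeasurable⟩
    exact (intervalIntegral.integral_hasDerivWithinAt_right hint' (s := Iic t) (t := Iic t)
      hmeas hcw).mono Icc_subset_Iic_self
  -- Replacing b by a in the equation for G costs (a - b)(∂ₓG)²/2 ≤ M²|a - b|/2, which the added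
  -- integral pays for.
  refine IsRegularFlow.le_of_subsolution_of_supersolution (a := a) (hF.isRegularFlow hφ)
    ((hG.isRegularFlow hψ).add (IsRegularFlow.of_time hcont hderiv))
    (fun t ht => ha.mapsTo ⟨ht.1.le, ht.2⟩) (fun x t ht => le_rfl) (fun x t ht => ?_)
    (fun x => ?_) ht
  · have h1 : (deriv (fun y => G y t) x) ^ 2 ≤ M ^ 2 := sq_le_sq' (abs_le.1 (hM t ht x)).1
      (abs_le.1 (hM t ht x)).2
    have h2 := mul_le_mul (le_abs_self (a t - b t)) h1 (sq_nonneg _) (abs_nonneg _)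
    simp only [add_zero]
    linarith
  · simpa [hF.initial, hG.initial] using hc x

theorem le_add_const (hφ : LipschitzWith K φ) (hψ : LipschitzWith K' ψ)
    (ha : IsOrderParameter a) (hF : IsParisiPDESolution φ a F) (hG : IsParisiPDESolution ψ a G)
    {c : ℝ} (hc : ∀ x, φ x ≤ ψ x + c) {x t : ℝ} (ht : t ∈ Icc (0 : ℝ) 1) :
    F x t ≤ G x t + c := by
  obtain ⟨M, hM⟩ := hG.bounded_gradient
  simpa using hF.le_add_integral hφ hψ ha ha hG hM hc (x := x) ht

theorem comp_add_const (hF : IsParisiPDESolution φ a F) (h : ℝ) :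
    IsParisiPDESolution (fun x => φ (x + h)) a (fun x t => F (x + h) t) := by
  have hd : ∀ t, deriv (fun y => F (y + h) t) = fun x => deriv (fun y => F y t) (x + h) :=
    fun t => funext fun x => deriv_comp_add_const (fun y => F y t) h x
  have hdd : ∀ t, deriv (fun x => deriv (fun y => F y t) (x + h)) =
      fun x => deriv (deriv (fun y => F y t)) (x + h) :=
    fun t => funext fun x => deriv_comp_add_const (deriv fun y => F y t) h x
  refine ⟨?_, fun x => hF.initial _, fun t ht => ?_, fun t ht => ?_, ?_, fun x t ht => ?_⟩
  · exact hF.continuousOn.comp (f := fun q : ℝ × ℝ => (q.1 + h, q.2)) (by fun_prop)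
      fun q hq => ⟨mem_univ _, hq.2⟩
  · exact (hF.differentiable t ht).comp (differentiable_id.add_const h)
  · rw [hd]
    exact (hF.differentiable_deriv t ht).comp (differentiable_id.add_const h)
  · obtain ⟨L, hL⟩ := hF.bounded_gradient
    refine ⟨L, fun t ht x => ?_⟩
    rw [hd]
    exact hL t ht _
  · rw [hd, hdd]
    exact hF.equation _ t ht

theorem comp_neg (hF : IsParisiPDESolution φ a F) :
    IsParisiPDESolution (fun x => φ (-x)) a (fun x t => F (-x) t) := by
  have hd : ∀ t, deriv (fun y => F (-y) t) = fun x => -deriv (fun y => F y t) (-x) :=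
    fun t => funext fun x => deriv_comp_neg (fun y => F y t) x
  have hdd : ∀ t, deriv (fun x => -deriv (fun y => F y t) (-x)) =
      fun x => deriv (deriv (fun y => F y t)) (-x) :=
    fun t => funext fun x => by
      rw [deriv.fun_neg, deriv_comp_neg (deriv fun y => F y t) x, neg_neg]
  refine ⟨?_, fun x => hF.initial _, fun t ht => ?_, fun t ht => ?_, ?_, fun x t ht => ?_⟩
  · exact hF.continuousOn.comp (f := fun q : ℝ × ℝ => (-q.1, q.2)) (by fun_prop)
      fun q hq => ⟨mem_univ _, hq.2⟩
  · exact (hF.differentiable t ht).comp differentiable_id.neg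
  · rw [hd]
    exact ((hF.differentiable_deriv t ht).comp differentiable_id.neg).neg
  · obtain ⟨L, hL⟩ := hF.bounded_gradient
    refine ⟨L, fun t ht x => ?_⟩
    rw [hd, abs_neg]
    exact hL t ht _
  · rw [hd, hdd, neg_sq]
    exact hF.equation _ t ht

/-- The reflected function solves the same problem, and comparison in both directions identifies the
two. -/
theorem even (hφ : LipschitzWith K φ) (ha : IsOrderParameter a)
    (hF : IsParisiPDESolution φ a F) (heven : φ.Even) {t : ℝ} (ht : t ∈ Icc (0 : ℝ) 1) (x : ℝ) :
    F (-x) t = F x t := by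
  have hφ' : (fun x => φ (-x)) = φ := funext heven
  have hF' : IsParisiPDESolution φ a (fun x t => F (-x) t) := hφ' ▸ hF.comp_neg
  refine le_antisymm ?_ ?_
  · simpa using hF'.le_add_const hφ hφ ha hF (c := 0) (by simp) (x := x) ht
  · simpa using hF.le_add_const hφ hφ ha hF' (c := 0) (by simp) (x := x) ht

theorem monotone (hφ : LipschitzWith K φ) (ha : IsOrderParameter a)
    (hF : IsParisiPDESolution φ a F) (hmono : Monotone φ) {t : ℝ} (ht : t ∈ Icc (0 : ℝ) 1) :
    Monotone fun x => F x t := by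
  intro x y hxy
  have hφ' : LipschitzWith K fun z => φ (z + (y - x)) := by
    have := hφ.comp (LipschitzWith.id.add (LipschitzWith.const (y - x)))
    simpa [Function.comp_def] using this
  have := hF.le_add_const hφ hφ' ha (hF.comp_add_const (y - x)) (c := 0)
    (fun z => by simpa using hmono (by linarith : z ≤ z + (y - x))) (x := x) ht
  simpa using this

/-- A translate by h is again a solution, its datum exceeds φ by at most K|h|, and comparison keeps
that bound for all times. -/
theorem lipschitzWith (hφ : LipschitzWith K φ) (ha : IsOrderParameter a)
    (hF : IsParisiPDESolution φ a F) {t : ℝ} (ht : t ∈ Icc (0 : ℝ) 1) :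
    LipschitzWith K fun x => F x t := by
  refine LipschitzWith.of_le_add_mul K fun y x => ?_
  have hφ' : LipschitzWith K fun z => φ (z + (y - x)) := by
    have := hφ.comp (LipschitzWith.id.add (LipschitzWith.const (y - x)))
    simpa [Function.comp_def] using this
  have := (hF.comp_add_const (y - x)).le_add_const hφ' hφ ha hF (c := K * |y - x|)
    (fun z => by simpa using hφ.le_add_mul_abs (z + (y - x)) z) (x := x) ht
  rw [Real.dist_eq]
  simpa using this

theorem abs_deriv_le (hφ : LipschitzWith K φ) (ha : IsOrderParameter a)
    (hF : IsParisiPDESolution φ a F) :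
    ∀ t ∈ Ioc (0 : ℝ) 1, ∀ x, |deriv (fun y => F y t) x| ≤ K := fun _ ht _ =>
  norm_deriv_le_of_lipschitz (hF.lipschitzWith hφ ha ⟨ht.1.le, ht.2⟩)

/-- The gradient bound K is inherited from φ alone, so the estimate is uniform over all order
parameters. -/
theorem abs_sub_le_integral (hφ : LipschitzWith K φ) (ha : IsOrderParameter a)
    (hb : IsOrderParameter b) (hF : IsParisiPDESolution φ a F) (hG : IsParisiPDESolution φ b G)
    {x t : ℝ} (ht : t ∈ Icc (0 : ℝ) 1) :
    |F x t - G x t| ≤ K ^ 2 / 2 * ∫ s in (0 : ℝ)..t, |a s - b s| := by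
  have h1 := hF.le_add_integral hφ hφ ha hb hG (hG.abs_deriv_le hφ hb) (c := 0) (by simp)
    (x := x) ht
  have h2 := hG.le_add_integral hφ hφ hb ha hF (hF.abs_deriv_le hφ ha) (c := 0) (by simp)
    (x := x) ht
  simp only [abs_sub_comm (b _) (a _)] at h2
  rw [abs_le]
  constructor <;> linarith

end IsParisiPDESolution

/-! ### Preservation of convexity and ordering of gradients -/

theorem HasDerivAt.nonneg_of_le_right {f : ℝ → ℝ} {c x : ℝ} (hf : HasDerivAt f c x)
    (h : ∀ y, x ≤ y → f x ≤ f y) : 0 ≤ c := by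
  have h1 := hasDerivWithinAt_iff_tendsto_slope.1 (hf.hasDerivWithinAt (s := Ici x))
  rw [Ici_sdiff_left] at h1
  refine ge_of_tendsto h1 ?_
  filter_upwards [self_mem_nhdsWithin] with y hy
  rw [slope_def_field]
  exact div_nonneg (sub_nonneg.2 (h y (le_of_lt hy))) (sub_nonneg.2 (le_of_lt hy))

namespace IsParisiPDESolution

variable {φ φ₁ φ₂ a a₁ a₂ : ℝ → ℝ} {F F₁ F₂ : ℝ → ℝ → ℝ} {K K₁ K₂ : NNReal}

/-- The minimum principle is applied to W = αF(x) + βF(y) - F(αx + βy). Since α + β = 1, shifting x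
and y by s shifts αx + βy by s, so the diagonal second derivative of W is the same combination of
the values of ∂ₓₓF. For v = αp(x) + βp(y) one has v² ≤ αp(x)² + βp(y)² and v - p(αx + βy) = ∂ₓW +
∂ᵧW, so the nonlinear terms contribute at least a bounded drift. -/
theorem convexOn (hφ : LipschitzWith K φ) (ha : IsOrderParameter a)
    (hF : IsParisiPDESolution φ a F) (hconv : ConvexOn ℝ univ φ) {t : ℝ}
    (ht : t ∈ Icc (0 : ℝ) 1) : ConvexOn ℝ univ fun x => F x t := by
  refine ⟨convex_univ, fun x _ y _ α β hα hβ hαβ => ?_⟩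
  have hreg := hF.isRegularFlow hφ
  obtain ⟨C, hC⟩ := hreg.growth
  have hC0 : 0 ≤ C := by
    have := (abs_nonneg _).trans (hC 0 1 (by simp))
    simpa using this
  have hα1 : α ≤ 1 := by linarith
  have hβ1 : β ≤ 1 := by linarith
  have hL := hF.abs_deriv_le hφ ha
  suffices h : 0 ≤ (fun (z : ℝ × ℝ) t =>
      α * F z.1 t + β * F z.2 t - F (α * z.1 + β * z.2) t) (x, y) t by
    simp only [smul_eq_mul]
    simp only at h
    linarith
  refine parabolic_min_principle (D := univ)
    (W := fun z t => α * F z.1 t + β * F z.2 t - F (α * z.1 + β * z.2) t)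
    isClosed_univ (C := 3 * C) (K := K) ?_ K.2 (fun z _ t ht => ?_) (fun z _ => ?_)
    (by simp) (fun z _ t ht => ?_) _ (mem_univ _) t ht
  · have hc : ∀ m : ℝ × ℝ → ℝ, Continuous m →
        ContinuousOn (fun q : (ℝ × ℝ) × ℝ => F (m q.1) q.2) (univ ×ˢ Icc 0 1) := fun m hm =>
      hreg.continuousOn.comp (f := fun q : (ℝ × ℝ) × ℝ => (m q.1, q.2)) (by fun_prop)
        fun q hq => ⟨mem_univ _, hq.2⟩
    exact ((((hc _ continuous_fst).const_mul α)).add ((hc _ continuous_snd).const_mul β)).sub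
      (hc (fun z => α * z.1 + β * z.2) (by fun_prop))
  · have h1 := (abs_le.1 (hC z.1 t ht)).1
    have h2 := (abs_le.1 (hC z.2 t ht)).1
    have h3 := (abs_le.1 (hC (α * z.1 + β * z.2) t ht)).2
    have h4 : |α * z.1 + β * z.2| ≤ |z.1| + |z.2| := by
      refine (abs_add_le _ _).trans (add_le_add ?_ ?_)
      · rw [abs_mul, abs_of_nonneg hα]
        exact mul_le_of_le_one_left (abs_nonneg _) hα1
      · rw [abs_mul, abs_of_nonneg hβ]
        exact mul_le_of_le_one_left (abs_nonneg _) hβ1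
    have h5 := mul_le_mul_of_nonneg_left h4 hC0
    have h6 : 0 ≤ C * (1 + |z.1|) := by positivity
    have h7 : 0 ≤ C * (1 + |z.2|) := by positivity
    have h8 := mul_le_mul_of_nonneg_left h1 hα
    have h9 := mul_le_mul_of_nonneg_left h2 hβ
    have h10 := mul_le_of_le_one_left h6 hα1
    have h11 := mul_le_of_le_one_left h7 hβ1
    have h12 : 0 ≤ C * |z.1| := by positivity
    have h13 : 0 ≤ C * |z.2| := by positivity
    linarith
  · have := hconv.2 (mem_univ z.1) (mem_univ z.2) hα hβ hαβ
    simp only [smul_eq_mul] at this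
    simp only [hF.initial]
    linarith
  · have hshift : ∀ s, α * (z.1 + s) + β * (z.2 + s) = α * z.1 + β * z.2 + s := fun s => by
      linear_combination s * hαβ
    set m := α * z.1 + β * z.2 with hm
    let p := fun x => deriv (fun y => F y t) x
    let q := fun x => deriv p x
    have hp : ∀ x, HasDerivAt (fun y => F y t) (p x) x := fun x => hreg.hasDerivAt x t ht
    have hq : ∀ x, HasDerivAt p (q x) x := fun x => hreg.hasDerivAt_deriv x t ht
    have hr : ∀ x, HasDerivWithinAt (F x) ((q x + a t * p x ^ 2) / 2) (Icc 0 t) t :=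
      fun x => hreg.hasDerivWithinAt x t ht
    refine ⟨α * ((q z.1 + a t * p z.1 ^ 2) / 2) + β * ((q z.2 + a t * p z.2 ^ 2) / 2) -
      (q m + a t * p m ^ 2) / 2, α * p z.1 - p m * α, β * p z.2 - p m * β,
      α * q z.1 + β * q z.2 - q m,
      fun s => α * p (z.1 + s) + β * p (z.2 + s) - p (m + s),
      (((hr _).const_mul α).add ((hr _).const_mul β)).sub (hr _), ?_, ?_, fun s => ?_, ?_, ?_⟩
    · have h1 : HasDerivAt (fun s => α * s + β * z.2) α z.1 := by
        simpa using ((hasDerivAt_id z.1).const_mul α).add_const (β * z.2)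
      have h2 : HasDerivAt (fun s => F (α * s + β * z.2) t) (p m * α) z.1 :=
        HasDerivAt.comp (h₂ := fun y => F y t) z.1 (hp m) h1
      exact (((hp z.1).const_mul α).add_const (β * F z.2 t)).sub h2
    · have h1 : HasDerivAt (fun s => α * z.1 + β * s) β z.2 := by
        simpa using ((hasDerivAt_id z.2).const_mul β).const_add (α * z.1)
      have h2 : HasDerivAt (fun s => F (α * z.1 + β * s) t) (p m * β) z.2 :=
        HasDerivAt.comp (h₂ := fun y => F y t) z.2 (hp m) h1
      exact (((hp z.2).const_mul β).const_add (α * F z.1 t)).sub h2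
    · simp only [hshift]
      exact ((((hp _).comp_const_add z.1 s).const_mul α).add
        (((hp _).comp_const_add z.2 s).const_mul β)).sub ((hp _).comp_const_add m s)
    · exact (((hq z.1).comp_const_add_zero.const_mul α).add
        ((hq z.2).comp_const_add_zero.const_mul β)).sub (hq m).comp_const_add_zero
    · set v := α * p z.1 + β * p z.2 with hv
      have hwxy : (α * p z.1 - p m * α) + (β * p z.2 - p m * β) = v - p m := by
        linear_combination -p m * hαβ
      have h1 : |v - p m| ≤ |α * p z.1 - p m * α| + |β * p z.2 - p m * β| :=
        hwxy ▸ abs_add_le _ _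
      have h2 : v ^ 2 ≤ α * p z.1 ^ 2 + β * p z.2 ^ 2 := by
        have h : α * p z.1 ^ 2 + β * p z.2 ^ 2 - v ^ 2 = α * β * (p z.1 - p z.2) ^ 2 := by
          have hβ' : β = 1 - α := by linarith
          rw [hv, hβ']
          ring
        have : 0 ≤ α * β * (p z.1 - p z.2) ^ 2 := by positivity
        linarith
      have hvK : |v| ≤ K := by
        refine (abs_add_le _ _).trans ?_
        rw [abs_mul, abs_mul, abs_of_nonneg hα, abs_of_nonneg hβ]
        have e1 := mul_le_mul_of_nonneg_left (hL t ht z.1) hα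
        have e2 := mul_le_mul_of_nonneg_left (hL t ht z.2) hβ
        have : (K : ℝ) = α * K + β * K := by rw [← add_mul, hαβ, one_mul]
        rw [this]
        exact add_le_add e1 e2
      have h3 : |v + p m| ≤ 2 * K := by
        have := abs_add_le v (p m)
        have := hL t ht m
        simp only [p] at *
        linarith
      have hat := ha.mapsTo (show t ∈ Icc (0 : ℝ) 1 from ⟨ht.1.le, ht.2⟩)
      have h4 : |a t * ((v + p m) * (v - p m))| ≤ 1 * (2 * K * |v - p m|) := by
        rw [abs_mul, abs_mul, abs_of_nonneg hat.1]
        gcongr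
        exact hat.2
      have h5 := (abs_le.1 h4).1
      have h6 := mul_le_mul_of_nonneg_left h1 K.2
      have h7 := mul_le_mul_of_nonneg_left h2 hat.1
      simp only [NNReal.val_eq_coe] at h6
      linarith

theorem monotone_deriv (hφ : LipschitzWith K φ) (ha : IsOrderParameter a)
    (hF : IsParisiPDESolution φ a F) (hconv : ConvexOn ℝ univ φ) {t : ℝ}
    (ht : t ∈ Ioc (0 : ℝ) 1) : Monotone (deriv fun x => F x t) := by
  have h := (hF.convexOn hφ ha hconv ⟨ht.1.le, ht.2⟩).monotoneOn_deriv
    fun x _ => hF.differentiable t ht x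
  exact monotoneOn_univ.1 h

theorem deriv_neg_of_even (hφ : LipschitzWith K φ) (ha : IsOrderParameter a)
    (hF : IsParisiPDESolution φ a F) (heven : φ.Even) {t : ℝ} (ht : t ∈ Ioc (0 : ℝ) 1) (x : ℝ) :
    deriv (fun y => F y t) (-x) = -deriv (fun y => F y t) x := by
  have h : (fun y => F (-y) t) = fun y => F y t :=
    funext (hF.even hφ ha heven ⟨ht.1.le, ht.2⟩)
  have := deriv_comp_neg (fun y => F y t) x
  rw [h] at this
  linarith

/-- Ordering of increments over pairs in a closed set `D` propagates in time. -/
theorem increment_le (hφ₁ : LipschitzWith K₁ φ₁) (hφ₂ : LipschitzWith K₂ φ₂)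
    (ha₁ : IsOrderParameter a₁) (ha₂ : IsOrderParameter a₂)
    (ha : ∀ t ∈ Icc (0 : ℝ) 1, a₁ t ≤ a₂ t)
    (hF₁ : IsParisiPDESolution φ₁ a₁ F₁) (hF₂ : IsParisiPDESolution φ₂ a₂ F₂)
    {D : Set (ℝ × ℝ)} (hD : IsClosed D)
    (hbdry : ∀ z ∈ D, z ∉ interior D → ∀ t ∈ Icc (0 : ℝ) 1,
      F₁ z.1 t = F₁ z.2 t ∧ F₂ z.1 t = F₂ z.2 t)
    (hsq : ∀ z ∈ D, ∀ t ∈ Ioc (0 : ℝ) 1,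
      deriv (fun y => F₁ y t) z.1 ^ 2 ≤ deriv (fun y => F₁ y t) z.2 ^ 2)
    (hinit : ∀ z ∈ D, φ₁ z.2 - φ₁ z.1 ≤ φ₂ z.2 - φ₂ z.1) :
    ∀ z ∈ D, ∀ t ∈ Icc (0 : ℝ) 1, F₁ z.2 t - F₁ z.1 t ≤ F₂ z.2 t - F₂ z.1 t := by
  intro z hz t ht
  have hL₁ := hF₁.abs_deriv_le hφ₁ ha₁
  have hL₂ := hF₂.abs_deriv_le hφ₂ ha₂
  have hreg := (hF₂.isRegularFlow hφ₂).add ((hF₁.isRegularFlow hφ₁).const_mul (-1))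
  obtain ⟨C, hC⟩ := hreg.growth
  have hC0 : 0 ≤ C := by
    have := (abs_nonneg _).trans (hC 0 1 (by simp))
    simpa using this
  set H : ℝ → ℝ → ℝ := fun x t => F₂ x t + -1 * F₁ x t with hH
  suffices h : 0 ≤ (fun (z : ℝ × ℝ) t => H z.2 t - H z.1 t) z t by
    simp only [hH] at h
    linarith
  -- An increment of H stands in for ∂ₓH, so no third derivative is needed.
  refine parabolic_min_principle (D := D) (W := fun z t => H z.2 t - H z.1 t) hD
    (C := 2 * C) (K := K₁ + K₂) ?_ (by positivity) (fun z _ t ht => ?_) (fun z hz => ?_)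
    (fun z hz hz' t ht => ?_) (fun z hz t ht => ?_) z hz t ht
  · have hc : ∀ m : ℝ × ℝ → ℝ, Continuous m →
        ContinuousOn (fun q : (ℝ × ℝ) × ℝ => H (m q.1) q.2) (D ×ˢ Icc 0 1) := fun m hm =>
      hreg.continuousOn.comp (f := fun q : (ℝ × ℝ) × ℝ => (m q.1, q.2)) (by fun_prop)
        fun q hq => ⟨mem_univ _, hq.2⟩
    exact (hc _ continuous_snd).sub (hc _ continuous_fst)
  · have h1 := (abs_le.1 (hC z.1 t ht)).2
    have h2 := (abs_le.1 (hC z.2 t ht)).1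
    have h3 : 0 ≤ C * |z.1| := by positivity
    have h4 : 0 ≤ C * |z.2| := by positivity
    simp only [hH]
    linarith
  · have := hinit z hz
    simp only [hH, hF₁.initial, hF₂.initial]
    linarith
  · obtain ⟨h1, h2⟩ := hbdry z hz hz' t ht
    simp only [hH, h1, h2]
    linarith
  · let p₁ := fun x => deriv (fun y => F₁ y t) x
    let p₂ := fun x => deriv (fun y => F₂ y t) x
    let q₁ := fun x => deriv p₁ x
    let q₂ := fun x => deriv p₂ x
    let p := fun x => p₂ x + -1 * p₁ x
    let q := fun x => q₂ x + -1 * q₁ x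
    let r := fun x => (q₂ x + a₂ t * p₂ x ^ 2) / 2 + -1 * ((q₁ x + a₁ t * p₁ x ^ 2) / 2)
    have hp : ∀ x, HasDerivAt (fun y => H y t) (p x) x := fun x => hreg.hasDerivAt x t ht
    have hq : ∀ x, HasDerivAt p (q x) x := fun x => hreg.hasDerivAt_deriv x t ht
    have hr : ∀ x, HasDerivWithinAt (H x) (r x) (Icc 0 t) t :=
      fun x => hreg.hasDerivWithinAt x t ht
    refine ⟨r z.2 - r z.1, -p z.1, p z.2, q z.2 - q z.1, fun s => p (z.2 + s) - p (z.1 + s),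
      (hr _).sub (hr _), (hp z.1).const_sub (H z.2 t), (hp z.2).sub_const (H z.1 t),
      fun s => ((hp _).comp_const_add z.2 s).sub ((hp _).comp_const_add z.1 s), ?_, ?_⟩
    · exact (hq z.2).comp_const_add_zero.sub (hq z.1).comp_const_add_zero
    · have ht' : t ∈ Icc (0 : ℝ) 1 := ⟨ht.1.le, ht.2⟩
      have hat := ha₂.mapsTo ht'
      have key : ∀ x, |a₂ t * (p₂ x ^ 2 - p₁ x ^ 2)| ≤ 1 * ((K₁ + K₂) * |p x|) := by
        intro x
        -- The nonlinearity splits as a₂p₂² - a₁p₁² = a₂(p₂² - p₁²) + (a₂ - a₁)p₁². The first part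
        -- is a drift in ∂ₓH; the increment of the second is nonnegative by `hsq`.
        have : p₂ x ^ 2 - p₁ x ^ 2 = (p₁ x + p₂ x) * p x := by simp only [p]; ring
        rw [this, abs_mul, abs_mul, abs_of_nonneg hat.1]
        gcongr
        · exact hat.2
        · exact (abs_add_le _ _).trans (add_le_add (hL₁ t ht x) (hL₂ t ht x))
      have h1 := (abs_le.1 (key z.1)).2
      have h2 := (abs_le.1 (key z.2)).1
      have h3 : 0 ≤ (a₂ t - a₁ t) * (p₁ z.2 ^ 2 - p₁ z.1 ^ 2) :=
        mul_nonneg (sub_nonneg.2 (ha t ht')) (sub_nonneg.2 (hsq z (interior_subset hz) t ht))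
      have h4 : 0 ≤ (K₁ + K₂) * |p z.1| := by positivity
      have h5 : 0 ≤ (K₁ + K₂) * |p z.2| := by positivity
      rw [abs_neg]
      simp only [r, q]
      linarith

/-- On the half-plane x ≤ y the boundary is the diagonal, where increments vanish. There p₁ is
nonnegative by monotonicity and nondecreasing by convexity, so its square is ordered too. -/
theorem sq_deriv_le_of_monotone (hφ₁ : LipschitzWith K₁ φ₁) (hφ₂ : LipschitzWith K₂ φ₂)
    (hφ : (φ₁, φ₂) ∈ monotonePairs)
    (ha₁ : IsOrderParameter a₁) (ha₂ : IsOrderParameter a₂)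
    (ha : ∀ t ∈ Icc (0 : ℝ) 1, a₁ t ≤ a₂ t)
    (hF₁ : IsParisiPDESolution φ₁ a₁ F₁) (hF₂ : IsParisiPDESolution φ₂ a₂ F₂)
    {t : ℝ} (ht : t ∈ Ioc (0 : ℝ) 1) (x : ℝ) :
    deriv (fun y => F₁ y t) x ^ 2 ≤ deriv (fun y => F₂ y t) x ^ 2 := by
  obtain ⟨hadm₁, hadm₂, hmono₁, -, hconv₁, -, -, hderiv⟩ := hφ
  simp only at hadm₁ hadm₂ hmono₁ hconv₁ hderiv
  have hnonneg : ∀ s ∈ Ioc (0 : ℝ) 1, ∀ y, 0 ≤ deriv (fun y => F₁ y s) y := fun s hs y =>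
    (hF₁.monotone hφ₁ ha₁ hmono₁ ⟨hs.1.le, hs.2⟩).deriv_nonneg
  have hincr := increment_le (D := {z : ℝ × ℝ | z.1 ≤ z.2}) hφ₁ hφ₂ ha₁ ha₂ ha hF₁ hF₂
    (isClosed_le continuous_fst continuous_snd) (fun z hz hz' s _ => ?_) (fun z hz s hs => ?_)
    (fun z hz => ?_)
  · have hle : deriv (fun y => F₁ y t) x ≤ deriv (fun y => F₂ y t) x := by
      refine sub_nonneg.1 (HasDerivAt.nonneg_of_le_right
        ((hF₂.differentiable t ht x).hasDerivAt.sub (hF₁.differentiable t ht x).hasDerivAt) ?_)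
      intro y hy
      have := hincr (x, y) hy t ⟨ht.1.le, ht.2⟩
      simp only [Pi.sub_apply]
      linarith
    exact pow_le_pow_left₀ (hnonneg t ht x) hle 2
  · have heq : z.1 = z.2 := by
      by_contra h
      have hsub : {z : ℝ × ℝ | z.1 < z.2} ⊆ {z | z.1 ≤ z.2} :=
        fun w (hw : w.1 < w.2) => hw.le
      exact hz' (interior_maximal hsub
        (isOpen_lt continuous_fst continuous_snd) (lt_of_le_of_ne hz h))
    simp [heq]
  · exact pow_le_pow_left₀ (hnonneg s hs _) (hF₁.monotone_deriv hφ₁ ha₁ hconv₁ hs hz) 2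
  · have : Monotone (φ₂ - φ₁) := monotone_of_deriv_nonneg
      (hadm₂.differentiable.sub hadm₁.differentiable) fun y => by
        rw [deriv_sub (hadm₂.differentiable y) (hadm₁.differentiable y)]
        exact sub_nonneg.2 (hderiv y)
    have := this hz
    simp only [Pi.sub_apply] at this
    linarith

/-- The cone |x| ≤ y is used because evenness makes increments vanish on its whole boundary, which
fails on the edge x = 0 of the region 0 ≤ x ≤ y. Since p₁ is odd and nondecreasing, |p₁(x)| ≤ p₁(y)
on the cone. -/
theorem sq_deriv_le_of_even (hφ₁ : LipschitzWith K₁ φ₁) (hφ₂ : LipschitzWith K₂ φ₂)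
    (hφ : (φ₁, φ₂) ∈ evenPairs)
    (ha₁ : IsOrderParameter a₁) (ha₂ : IsOrderParameter a₂)
    (ha : ∀ t ∈ Icc (0 : ℝ) 1, a₁ t ≤ a₂ t)
    (hF₁ : IsParisiPDESolution φ₁ a₁ F₁) (hF₂ : IsParisiPDESolution φ₂ a₂ F₂)
    {t : ℝ} (ht : t ∈ Ioc (0 : ℝ) 1) (x : ℝ) :
    deriv (fun y => F₁ y t) x ^ 2 ≤ deriv (fun y => F₂ y t) x ^ 2 := by
  obtain ⟨hadm₁, hadm₂, heven₁, heven₂, hconv₁, -, -, hderiv⟩ := hφ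
  simp only at hadm₁ hadm₂ heven₁ heven₂ hconv₁ hderiv
  have habs : ∀ {G : ℝ → ℝ}, (∀ y, G (-y) = G y) → ∀ y, G |y| = G y := fun hG y => by
    rcases abs_choice y with h | h <;> rw [h]
    exact hG y
  have hodd₁ := fun {s : ℝ} (hs : s ∈ Ioc (0 : ℝ) 1) => hF₁.deriv_neg_of_even hφ₁ ha₁ heven₁ hs
  have hodd₂ := fun {s : ℝ} (hs : s ∈ Ioc (0 : ℝ) 1) => hF₂.deriv_neg_of_even hφ₂ ha₂ heven₂ hs
  have hincr := increment_le (D := {z : ℝ × ℝ | |z.1| ≤ z.2}) hφ₁ hφ₂ ha₁ ha₂ ha hF₁ hF₂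
    (isClosed_le (by fun_prop) continuous_snd) (fun z hz hz' s hs => ?_) (fun z hz s hs => ?_)
    (fun z hz => ?_)
  · rw [← habs (G := fun x => deriv (fun y => F₁ y t) x ^ 2) (fun y => by rw [hodd₁ ht, neg_sq]),
      ← habs (G := fun x => deriv (fun y => F₂ y t) x ^ 2) (fun y => by rw [hodd₂ ht, neg_sq])]
    have hnonneg : 0 ≤ deriv (fun y => F₁ y t) |x| := by
      have h := hF₁.monotone_deriv hφ₁ ha₁ hconv₁ ht (neg_le_self (abs_nonneg x))
      rw [hodd₁ ht] at h
      linarith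
    have hle : deriv (fun y => F₁ y t) |x| ≤ deriv (fun y => F₂ y t) |x| := by
      refine sub_nonneg.1 (HasDerivAt.nonneg_of_le_right ((hF₂.differentiable t ht _).hasDerivAt.sub
        (hF₁.differentiable t ht _).hasDerivAt) ?_)
      intro y hy
      have := hincr (|x|, y) (by simpa using hy) t ⟨ht.1.le, ht.2⟩
      simp only [Pi.sub_apply]
      linarith
    exact pow_le_pow_left₀ hnonneg hle 2
  · have heq : |z.1| = z.2 := by
      by_contra h
      have hsub : {z : ℝ × ℝ | |z.1| < z.2} ⊆ {z | |z.1| ≤ z.2} :=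
        fun w (hw : |w.1| < w.2) => hw.le
      exact hz' (interior_maximal hsub
        (isOpen_lt (by fun_prop) continuous_snd) (lt_of_le_of_ne hz h))
    rw [← heq]
    exact ⟨(habs (G := fun x => F₁ x s) (hF₁.even hφ₁ ha₁ heven₁ hs) _).symm,
      (habs (G := fun x => F₂ x s) (hF₂.even hφ₂ ha₂ heven₂ hs) _).symm⟩
  · obtain ⟨h1, h2⟩ := abs_le.1 (show |z.1| ≤ z.2 from hz)
    refine sq_le_sq' ?_ (hF₁.monotone_deriv hφ₁ ha₁ hconv₁ hs h2)
    rw [← hodd₁ hs]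
    exact hF₁.monotone_deriv hφ₁ ha₁ hconv₁ hs h1
  · have : MonotoneOn (φ₂ - φ₁) (Ici 0) := by
      refine monotoneOn_of_deriv_nonneg (convex_Ici 0)
        (hadm₂.differentiable.sub hadm₁.differentiable).continuous.continuousOn
        (hadm₂.differentiable.sub hadm₁.differentiable).differentiableOn fun y hy => ?_
      rw [deriv_sub (hadm₂.differentiable y) (hadm₁.differentiable y)]
      exact sub_nonneg.2 (hderiv y (interior_subset hy))
    have := this (abs_nonneg z.1) ((abs_nonneg z.1).trans hz) hz
    simp only [Pi.sub_apply, habs heven₁, habs heven₂] at this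
    linarith

theorem sq_deriv_le (hφ₁ : LipschitzWith K₁ φ₁) (hφ₂ : LipschitzWith K₂ φ₂)
    (hφ : (φ₁, φ₂) ∈ orderedPairs)
    (ha₁ : IsOrderParameter a₁) (ha₂ : IsOrderParameter a₂)
    (ha : ∀ t ∈ Icc (0 : ℝ) 1, a₁ t ≤ a₂ t)
    (hF₁ : IsParisiPDESolution φ₁ a₁ F₁) (hF₂ : IsParisiPDESolution φ₂ a₂ F₂)
    {t : ℝ} (ht : t ∈ Ioc (0 : ℝ) 1) (x : ℝ) :
    deriv (fun y => F₁ y t) x ^ 2 ≤ deriv (fun y => F₂ y t) x ^ 2 := by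
  rcases hφ with h | h
  · exact sq_deriv_le_of_monotone hφ₁ hφ₂ h ha₁ ha₂ ha hF₁ hF₂ ht x
  · exact sq_deriv_le_of_even hφ₁ hφ₂ h ha₁ ha₂ ha hF₁ hF₂ ht x

/-- Once the squared gradients are ordered, the convex combination is a supersolution; `h3` is the
identity behind this. -/
theorem le_convex_combination (hφ₁ : LipschitzWith K₁ φ₁) (hφ₂ : LipschitzWith K₂ φ₂)
    (hφ : (φ₁, φ₂) ∈ orderedPairs)
    (ha₁ : IsOrderParameter a₁) (ha₂ : IsOrderParameter a₂)
    (ha : ∀ t ∈ Icc (0 : ℝ) 1, a₁ t ≤ a₂ t)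
    (hF₁ : IsParisiPDESolution φ₁ a₁ F₁) (hF₂ : IsParisiPDESolution φ₂ a₂ F₂)
    {α : ℝ} (hα : α ∈ Icc (0 : ℝ) 1)
    (hφ' : LipschitzWith K fun y => α * φ₁ y + (1 - α) * φ₂ y)
    (hF : IsParisiPDESolution (fun y => α * φ₁ y + (1 - α) * φ₂ y)
      (fun t => α * a₁ t + (1 - α) * a₂ t) F) {t : ℝ} (ht : t ∈ Icc (0 : ℝ) 1) (x : ℝ) :
    F x t ≤ α * F₁ x t + (1 - α) * F₂ x t := by
  have hα' : 0 ≤ 1 - α := sub_nonneg.2 hα.2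
  refine IsRegularFlow.le_of_subsolution_of_supersolution
    (a := fun t => α * a₁ t + (1 - α) * a₂ t) (hF.isRegularFlow hφ')
    (((hF₁.isRegularFlow hφ₁).const_mul α).add ((hF₂.isRegularFlow hφ₂).const_mul (1 - α)))
    (fun s hs => ?_) (fun y s hs => le_rfl) (fun y s hs => ?_) (fun y => ?_) ht
  · exact convex_Icc (0 : ℝ) 1 (ha₁.mapsTo ⟨hs.1.le, hs.2⟩) (ha₂.mapsTo ⟨hs.1.le, hs.2⟩)
      hα.1 hα' (by ring)
  · have hs' : s ∈ Icc (0 : ℝ) 1 := ⟨hs.1.le, hs.2⟩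
    have hsq := sq_deriv_le hφ₁ hφ₂ hφ ha₁ ha₂ ha hF₁ hF₂ hs y
    set p₁ := deriv (fun y => F₁ y s) y
    set p₂ := deriv (fun y => F₂ y s) y
    have h1 : 0 ≤ α * (1 - α) * ((a₂ s - a₁ s) * (p₂ ^ 2 - p₁ ^ 2)) :=
      mul_nonneg (mul_nonneg hα.1 hα')
        (mul_nonneg (sub_nonneg.2 (ha s hs')) (sub_nonneg.2 hsq))
    have h2 : 0 ≤ (α * a₁ s + (1 - α) * a₂ s) * (α * (1 - α) * (p₂ - p₁) ^ 2) :=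
      mul_nonneg (add_nonneg (mul_nonneg hα.1 (ha₁.mapsTo hs').1)
        (mul_nonneg hα' (ha₂.mapsTo hs').1))
        (mul_nonneg (mul_nonneg hα.1 hα') (sq_nonneg _))
    have h3 : α * (a₁ s * p₁ ^ 2) + (1 - α) * (a₂ s * p₂ ^ 2) -
        (α * a₁ s + (1 - α) * a₂ s) * (α * p₁ + (1 - α) * p₂) ^ 2 =
        α * (1 - α) * ((a₂ s - a₁ s) * (p₂ ^ 2 - p₁ ^ 2)) +
        (α * a₁ s + (1 - α) * a₂ s) * (α * (1 - α) * (p₂ - p₁) ^ 2) := by ring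
    linarith
  · rw [hF.initial, hF₁.initial, hF₂.initial]

end IsParisiPDESolution

/-! ### Heat semigroup -/

open MeasureTheory ProbabilityTheory in
-- For the measure w dy these integrals are derivatives of the moment generating function of X,
-- which may be differentiated under the integral in the interior of `integrableExpSet`.
theorem integral_weight_pow_mul_exp {w X : ℝ → ℝ} (hw : Continuous w) (hw0 : ∀ y, 0 ≤ w y)
    {U : Set ℝ} (hU : IsOpen U)
    (hint : ∀ θ ∈ U, Integrable (fun y => w y * Real.exp (θ * X y))) (n : ℕ) {θ : ℝ} (hθ : θ ∈ U) :
    Integrable (fun y => w y * (X y ^ n * Real.exp (θ * X y))) ∧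
    HasDerivAt (fun θ => ∫ y, w y * (X y ^ n * Real.exp (θ * X y)))
      (∫ y, w y * (X y ^ (n + 1) * Real.exp (θ * X y))) θ := by
  set μ : Measure ℝ := volume.withDensity fun y => ENNReal.ofReal (w y) with hμ
  have hmeas : Measurable fun y => ENNReal.ofReal (w y) := hw.measurable.ennreal_ofReal
  have hlt : ∀ᵐ y, ENNReal.ofReal (w y) < ⊤ := ae_of_all _ fun _ => ENNReal.ofReal_lt_top
  have hI : ∀ f : ℝ → ℝ, Integrable f μ ↔ Integrable fun y => w y * f y := fun f => by
    rw [hμ, integrable_withDensity_iff_integrable_smul' hmeas hlt]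
    simp only [ENNReal.toReal_ofReal (hw0 _), smul_eq_mul]
  have hE : ∀ f : ℝ → ℝ, ∫ y, f y ∂μ = ∫ y, w y * f y := fun f => by
    rw [hμ, integral_withDensity_eq_integral_toReal_smul hmeas hlt]
    simp only [ENNReal.toReal_ofReal (hw0 _), smul_eq_mul]
  have hsub : U ⊆ integrableExpSet X μ := fun θ hθ => (hI _).2 (hint θ hθ)
  have hmem : θ ∈ interior (integrableExpSet X μ) := interior_maximal hsub hU hθ
  refine ⟨(hI _).1 (integrable_pow_mul_exp_of_mem_interior_integrableExpSet hmem n), ?_⟩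
  simp only [← hE]
  exact hasDerivAt_integral_pow_mul_exp_real hmem n

/-- The heat semigroup `∂ₜ = ∂ₓₓ / 2`. -/
noncomputable def heatFlow (u : ℝ → ℝ) (x t : ℝ) : ℝ :=
  ∫ z, u (x + √t * z) ∂ProbabilityTheory.gaussianReal 0 1

open MeasureTheory ProbabilityTheory in
-- In this form the time dependence of the integral is an exponential parameter r = 1/(2t)
-- multiplying -(x-y)².
theorem heatFlow_eq_integral_kernel (u : ℝ → ℝ) (x : ℝ) {t : ℝ} (ht : 0 < t) :
    heatFlow u x t = (√(2 * Real.pi * t))⁻¹ *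
      ∫ y, u y * Real.exp ((2 * t)⁻¹ * -(x - y) ^ 2) := by
  have hv : t.toNNReal ≠ 0 := by simpa using ht
  have hmap : (gaussianReal 0 1).map (fun z => x + √t * z) = gaussianReal x t.toNNReal := by
    have h : (fun z => x + √t * z) = (fun z => x + z) ∘ fun z => √t * z := rfl
    rw [h, ← Measure.map_map (by fun_prop) (by fun_prop), gaussianReal_map_const_mul,
      gaussianReal_map_const_add]
    congr 1
    · simp
    · ext
      simp [Real.sq_sqrt ht.le, Real.coe_toNNReal _ ht.le]
  have hemb : MeasurableEmbedding fun z => x + √t * z :=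
    (((Homeomorph.mulLeft₀ (√t) (Real.sqrt_pos.2 ht).ne').trans
      (Homeomorph.addLeft x)).measurableEmbedding)
  rw [heatFlow, ← hemb.integral_map, hmap, integral_gaussianReal_eq_integral_smul hv,
    ← integral_const_mul]
  congr 1
  ext y
  rw [gaussianPDFReal_def, Real.coe_toNNReal _ ht.le, smul_eq_mul, mul_assoc, mul_comm (u y)]
  congr 3
  field_simp
  ring

open MeasureTheory in
theorem integrable_exp_neg_mul_sq_add_mul {s : ℝ} (hs : 0 < s) (θ : ℝ) :
    Integrable fun y : ℝ => Real.exp (-s * y ^ 2 + θ * y) := by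
  have h := ((integrable_exp_neg_mul_sq hs).comp_sub_right (θ / (2 * s))).const_mul
    (Real.exp (θ ^ 2 / (4 * s)))
  refine h.congr (ae_of_all _ fun y => ?_)
  simp only
  rw [← Real.exp_add]
  congr 1
  field_simp
  ring

open MeasureTheory in
/-- The heat flow of a nonnegative function of subgaussian growth is smooth for `t > 0` and
solves the heat equation. -/
theorem heatFlow_heat_equation {u : ℝ → ℝ} (hu : Continuous u) (hu0 : ∀ y, 0 ≤ u y)
    (hint : ∀ s > 0, ∀ θ : ℝ, Integrable fun y => u y * Real.exp (-s * y ^ 2 + θ * y))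
    {t : ℝ} (ht : 0 < t) :
    ∃ p q : ℝ → ℝ, (∀ x, HasDerivAt (fun y => heatFlow u y t) (p x) x) ∧
      (∀ x, HasDerivAt p (q x) x) ∧
      ∀ x, HasDerivAt (fun s => heatFlow u x s) (q x / 2) t := by
  set s := (2 * t)⁻¹ with hs
  have hspos : 0 < s := by positivity
  -- Expanding (x-y)² leaves exponential moments of w at the parameter 2sx, so each x-derivative
  -- raises the moment by one.
  let w : ℝ → ℝ := fun y => u y * Real.exp (-s * y ^ 2)
  let M : ℕ → ℝ → ℝ := fun n θ => ∫ y, w y * (y ^ n * Real.exp (θ * y))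
  have hM := fun n θ => integral_weight_pow_mul_exp (w := w) (X := fun y => y) (by fun_prop)
    (fun y => mul_nonneg (hu0 y) (Real.exp_pos _).le) isOpen_univ (fun θ _ =>
      (hint s hspos θ).congr (ae_of_all _ fun y => by
        simp only [w]; rw [Real.exp_add]; ring)) n (mem_univ θ)
  have hMd : ∀ n x, HasDerivAt (fun x => M n (2 * s * x)) (M (n + 1) (2 * s * x) * (2 * s)) x := by
    intro n x
    have h1 : HasDerivAt (fun x => 2 * s * x) (2 * s) x := by
      simpa using (hasDerivAt_id x).const_mul (2 * s)
    exact HasDerivAt.comp (h₂ := M n) x (hM n _).2 h1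
  have hJ := fun x r (hr : r ∈ Ioi (0 : ℝ)) => integral_weight_pow_mul_exp (w := u)
    (X := fun y => -(x - y) ^ 2) hu hu0 isOpen_Ioi (fun r hr =>
      ((hint r hr (2 * r * x)).const_mul (Real.exp (-r * x ^ 2))).congr (ae_of_all _ fun y => by
        simp only
        rw [mul_left_comm, ← Real.exp_add]
        congr 2
        ring)) 0 hr
  have hexp : ∀ x y, Real.exp (s * -(x - y) ^ 2) =
      Real.exp (-s * x ^ 2) * (Real.exp (-s * y ^ 2) * Real.exp (2 * s * x * y)) := fun x y => by
    rw [← Real.exp_add, ← Real.exp_add]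
    congr 1
    ring
  let E : ℝ → ℝ := fun x => Real.exp (-s * x ^ 2)
  have hE : ∀ x, HasDerivAt E (E x * (-s * (2 * x))) x := fun x => by
    exact ((hasDerivAt_pow 2 x).const_mul (-s)).exp.congr_deriv (by simp [E])
  have hJ0 : ∀ x, ∫ y, u y * Real.exp (s * -(x - y) ^ 2) = E x * M 0 (2 * s * x) := by
    intro x
    simp only [M, E, w]
    rw [← integral_const_mul]
    congr 1
    ext y
    rw [hexp]
    ring
  -- The derivative in r is expressed through the moments that occur in the x-derivatives, which
  -- reduces the heat equation to algebra.
  have hJ1 : ∀ x, ∫ y, u y * ((-(x - y) ^ 2) ^ (0 + 1) * Real.exp (s * -(x - y) ^ 2)) =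
      E x * (-x ^ 2 * M 0 (2 * s * x) + 2 * x * M 1 (2 * s * x) - M 2 (2 * s * x)) := by
    intro x
    simp only [M]
    rw [← integral_const_mul, ← integral_const_mul, ← integral_add, ← integral_sub,
      ← integral_const_mul]
    · congr 1
      ext y
      rw [hexp]
      simp only [w, E]
      ring
    · exact ((hM 0 _).1.const_mul _).add ((hM 1 _).1.const_mul _)
    · exact (hM 2 _).1
    · exact (hM 0 _).1.const_mul _
    · exact (hM 1 _).1.const_mul _
  set c := (√(2 * Real.pi * t))⁻¹ with hc
  refine ⟨fun x => c * (E x * (-s * (2 * x)) * M 0 (2 * s * x) +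
      E x * (M 1 (2 * s * x) * (2 * s))),
    fun x => c * (((E x * (-s * (2 * x)) * (-s * (2 * x)) + E x * (-s * 2)) * M 0 (2 * s * x) +
        E x * (-s * (2 * x)) * (M 1 (2 * s * x) * (2 * s))) +
      (E x * (-s * (2 * x)) * (M 1 (2 * s * x) * (2 * s)) +
        E x * (M 2 (2 * s * x) * (2 * s) * (2 * s)))), fun x => ?_, fun x => ?_, fun x => ?_⟩
  · have h : (fun y => heatFlow u y t) = fun y => c * (E y * M 0 (2 * s * y)) := by
      ext y
      rw [heatFlow_eq_integral_kernel u y ht, ← hs, hJ0]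
    rw [h]
    exact ((hE x).mul (hMd 0 x)).const_mul c
  · have h1 : HasDerivAt (fun x => -s * (2 * x)) (-s * 2) x := by
      simpa using ((hasDerivAt_id x).const_mul 2).const_mul (-s)
    exact ((((hE x).mul h1).mul (hMd 0 x)).add ((hE x).mul ((hMd 1 x).mul_const _))).const_mul c
  · have hcd : HasDerivAt (fun t => (√(2 * Real.pi * t))⁻¹) (-(s * c)) t := by
      have h1 : HasDerivAt (fun t => 2 * Real.pi * t) (2 * Real.pi) t := by
        simpa using (hasDerivAt_id t).const_mul (2 * Real.pi)
      have hpos : 0 < 2 * Real.pi * t := by positivity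
      have h2 := (h1.sqrt hpos.ne').inv (Real.sqrt_pos.2 hpos).ne'
      refine h2.congr_deriv ?_
      rw [hs, hc]
      have h3 : √(2 * Real.pi * t) ≠ 0 := (Real.sqrt_pos.2 hpos).ne'
      have h4 := Real.sq_sqrt hpos.le
      field_simp
      rw [h4]
    have hsd : HasDerivAt (fun t : ℝ => (2 * t)⁻¹) (-(2 * s ^ 2)) t := by
      have h1 : HasDerivAt (fun t : ℝ => 2 * t) 2 t := by
        simpa using (hasDerivAt_id t).const_mul 2
      refine (h1.inv (by positivity)).congr_deriv ?_
      rw [hs]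
      field_simp
    have hd := HasDerivAt.comp (h₂ := fun r => ∫ y, u y * ((-(x - y) ^ 2) ^ 0 *
      Real.exp (r * -(x - y) ^ 2))) t (hJ x s hspos).2 hsd
    have hev : (fun r => heatFlow u x r) =ᶠ[𝓝 t] fun r => (√(2 * Real.pi * r))⁻¹ *
        ∫ y, u y * ((-(x - y) ^ 2) ^ 0 * Real.exp ((2 * r)⁻¹ * -(x - y) ^ 2)) := by
      filter_upwards [lt_mem_nhds ht] with r hr
      rw [heatFlow_eq_integral_kernel u x hr]
      simp only [pow_zero, one_mul]
    refine ((hcd.mul hd).congr_of_eventuallyEq hev).congr_deriv ?_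
    simp only [Function.comp_apply, ← hs, ← hc]
    rw [hJ1]
    simp only [pow_zero, one_mul]
    rw [hJ0]
    ring

/-! ### Cole–Hopf transform and existence for step parameters -/

theorem Real.exp_mul_abs_le (c z : ℝ) : Real.exp (c * |z|) ≤
    Real.exp (c * z) + Real.exp (-c * z) := by
  rcases abs_choice z with h | h <;> rw [h]
  · linarith [Real.exp_pos (-c * z)]
  · rw [mul_neg, ← neg_mul]
    linarith [Real.exp_pos (c * z)]

section ColeHopf

variable {ψ : ℝ → ℝ} {K : NNReal} {m : ℝ}

/-- A Gaussian-integrable majorant, locally uniform in x and c; it gives both integrability and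
dominated convergence. -/
theorem LipschitzWith.exp_mul_le (hψ : LipschitzWith K ψ) (hm : 0 ≤ m) {x c z R T : ℝ}
    (hx : |x| ≤ R) (hc : |c| ≤ T) : Real.exp (m * ψ (x + c * z)) ≤
      Real.exp (m * (ψ 0 + K * R)) * (Real.exp (m * K * T * z) + Real.exp (-(m * K * T) * z)) := by
  have h1 : ψ (x + c * z) ≤ ψ 0 + K * (R + T * |z|) := by
    refine (hψ.le_add_mul_abs _ 0).trans ?_
    have : |x + c * z - 0| ≤ R + T * |z| := by
      rw [sub_zero]
      refine (abs_add_le _ _).trans (add_le_add hx ?_)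
      rw [abs_mul]
      gcongr
    gcongr
  calc Real.exp (m * ψ (x + c * z)) ≤ Real.exp (m * (ψ 0 + K * (R + T * |z|))) := by gcongr
    _ = Real.exp (m * (ψ 0 + K * R)) * Real.exp (m * K * T * |z|) := by
        rw [← Real.exp_add]
        congr 1
        ring
    _ ≤ _ := by
        gcongr
        exact Real.exp_mul_abs_le _ _

open MeasureTheory ProbabilityTheory

theorem integrable_exp_add_exp_neg_gaussianReal (A B : ℝ) :
    Integrable (fun z => A * (Real.exp (B * z) + Real.exp (-B * z))) (gaussianReal 0 1) :=
  ((integrable_exp_mul_gaussianReal B).add (integrable_exp_mul_gaussianReal (-B))).const_mul A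

theorem LipschitzWith.integrable_exp_gaussianReal (hψ : LipschitzWith K ψ) (hm : 0 ≤ m)
    (x c : ℝ) : Integrable (fun z => Real.exp (m * ψ (x + c * z))) (gaussianReal 0 1) := by
  have hc := hψ.continuous
  refine (integrable_exp_add_exp_neg_gaussianReal (Real.exp (m * (ψ 0 + K * |x|)))
    (m * K * |c|)).mono' (by fun_prop) (ae_of_all _ fun z => ?_)
  rw [Real.norm_eq_abs, abs_of_pos (Real.exp_pos _)]
  exact hψ.exp_mul_le hm le_rfl le_rfl

/-- The representation by a standard Gaussian makes sense at t = 0, so continuity includes the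
initial time; for t < 0 the convention √t = 0 freezes the flow. -/
theorem LipschitzWith.continuous_heatFlow_exp (hψ : LipschitzWith K ψ) (hm : 0 ≤ m) :
    Continuous fun p : ℝ × ℝ => heatFlow (fun y => Real.exp (m * ψ y)) p.1 p.2 := by
  have hc := hψ.continuous
  rw [continuous_iff_continuousAt]
  rintro ⟨x₀, t₀⟩
  refine continuousAt_of_dominated (bound := fun z => Real.exp (m * (ψ 0 + K * (|x₀| + 1))) *
    (Real.exp (m * K * (|√t₀| + 1) * z) + Real.exp (-(m * K * (|√t₀| + 1)) * z)))
    (Eventually.of_forall fun p => by fun_prop) ?_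
    (integrable_exp_add_exp_neg_gaussianReal _ _) (ae_of_all _ fun z => by fun_prop)
  have h1 : ∀ᶠ p : ℝ × ℝ in 𝓝 (x₀, t₀), |p.1| < |x₀| + 1 :=
    ContinuousAt.eventually_lt (f := fun p : ℝ × ℝ => |p.1|) (g := fun _ => |x₀| + 1)
      (by fun_prop) (by fun_prop) (lt_add_one _)
  have h2 : ∀ᶠ p : ℝ × ℝ in 𝓝 (x₀, t₀), |√p.2| < |√t₀| + 1 :=
    ContinuousAt.eventually_lt (f := fun p : ℝ × ℝ => |√p.2|) (g := fun _ => |√t₀| + 1)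
      (by fun_prop) (by fun_prop) (lt_add_one _)
  filter_upwards [h1, h2] with p hp1 hp2
  refine ae_of_all _ fun z => ?_
  rw [Real.norm_eq_abs, abs_of_pos (Real.exp_pos _)]
  exact hψ.exp_mul_le hm hp1.le hp2.le

theorem LipschitzWith.heatFlow_exp_pos (hψ : LipschitzWith K ψ) (hm : 0 ≤ m) (x t : ℝ) :
    0 < heatFlow (fun y => Real.exp (m * ψ y)) x t :=
  integral_exp_pos (hψ.integrable_exp_gaussianReal hm x _)

theorem LipschitzWith.integrable_exp_mul_exp_neg_sq (hψ : LipschitzWith K ψ) (hm : 0 ≤ m) {s : ℝ}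
    (hs : 0 < s) (θ : ℝ) :
    Integrable fun y => Real.exp (m * ψ y) * Real.exp (-s * y ^ 2 + θ * y) := by
  have hc := hψ.continuous
  refine (((integrable_exp_neg_mul_sq_add_mul hs (m * K * 1 + θ)).add
    (integrable_exp_neg_mul_sq_add_mul hs (-(m * K * 1) + θ))).const_mul
      (Real.exp (m * (ψ 0 + K * 0)))).mono' (by fun_prop) (ae_of_all _ fun y => ?_)
  rw [Real.norm_eq_abs, abs_of_pos (by positivity)]
  have h := hψ.exp_mul_le hm (x := 0) (c := 1) (z := y) (R := 0) (T := 1) (by simp) (by simp)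
  rw [zero_add, one_mul] at h
  refine (mul_le_mul_of_nonneg_right h (Real.exp_pos _).le).trans (le_of_eq ?_)
  rw [mul_assoc, add_mul, ← Real.exp_add, ← Real.exp_add]
  simp only [Pi.add_apply]
  ring_nf

/-- The Cole–Hopf solution of `∂ₜF = (∂ₓₓF + m (∂ₓF)²) / 2` with initial condition `ψ`. -/
noncomputable def coleHopf (m : ℝ) (ψ : ℝ → ℝ) (x t : ℝ) : ℝ :=
  m⁻¹ * Real.log (heatFlow (fun y => Real.exp (m * ψ y)) x t)

theorem coleHopf_of_nonpos (hm : 0 < m) (ψ : ℝ → ℝ) (x : ℝ) {t : ℝ} (ht : t ≤ 0) :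
    coleHopf m ψ x t = ψ x := by
  simp [coleHopf, heatFlow, Real.sqrt_eq_zero_of_nonpos ht, hm.ne']

theorem LipschitzWith.continuous_coleHopf (hψ : LipschitzWith K ψ) (hm : 0 < m) :
    Continuous fun p : ℝ × ℝ => coleHopf m ψ p.1 p.2 :=
  ((hψ.continuous_heatFlow_exp hm.le).log fun p =>
    (hψ.heatFlow_exp_pos hm.le p.1 p.2).ne').const_mul _

/-- Moving from y to x multiplies the integrand by at most e^{mK|x-y|}; taking logarithms keeps the
constant K, so the construction can be iterated. -/
theorem LipschitzWith.coleHopf (hψ : LipschitzWith K ψ) (hm : 0 < m) (t : ℝ) :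
    LipschitzWith K fun x => coleHopf m ψ x t := by
  refine LipschitzWith.of_le_add_mul K fun x y => ?_
  have h1 : heatFlow (fun y => Real.exp (m * ψ y)) x t ≤
      Real.exp (m * (K * dist x y)) * heatFlow (fun y => Real.exp (m * ψ y)) y t := by
    rw [heatFlow, heatFlow, ← integral_const_mul]
    refine integral_mono (hψ.integrable_exp_gaussianReal hm.le x _)
      ((hψ.integrable_exp_gaussianReal hm.le y _).const_mul _) fun z => ?_
    simp only
    rw [← Real.exp_add, Real.exp_le_exp, ← mul_add]
    refine mul_le_mul_of_nonneg_left ?_ hm.le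
    have := hψ.le_add_mul_abs (x + √t * z) (y + √t * z)
    rw [add_sub_add_right_eq_sub] at this
    rw [Real.dist_eq]
    linarith
  have h2 := Real.log_le_log (hψ.heatFlow_exp_pos hm.le x t) h1
  rw [Real.log_mul (Real.exp_pos _).ne' (hψ.heatFlow_exp_pos hm.le y t).ne', Real.log_exp] at h2
  have h3 := mul_le_mul_of_nonneg_left h2 (inv_pos.2 hm).le
  rw [mul_add, inv_mul_cancel_left₀ hm.ne'] at h3
  rw [_root_.coleHopf, _root_.coleHopf]
  linarith

/-- For U the heat flow of e^{mψ}, p = Uₓ/(mU) gives q + mp² = Uₓₓ/(mU), which is twice the time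
derivative of m⁻¹ log U. -/
theorem LipschitzWith.coleHopf_equation (hψ : LipschitzWith K ψ) (hm : 0 < m) {t : ℝ}
    (ht : 0 < t) :
    ∃ p q : ℝ → ℝ, (∀ x, HasDerivAt (fun y => _root_.coleHopf m ψ y t) (p x) x) ∧
      (∀ x, HasDerivAt p (q x) x) ∧
      ∀ x, HasDerivAt (fun s => _root_.coleHopf m ψ x s) ((q x + m * p x ^ 2) / 2) t := by
  have hc := hψ.continuous
  obtain ⟨p, q, hp, hq, hr⟩ := heatFlow_heat_equation (u := fun y => Real.exp (m * ψ y))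
    (by fun_prop) (fun y => (Real.exp_pos _).le)
    (fun s hs θ => hψ.integrable_exp_mul_exp_neg_sq hm.le hs θ) ht
  have hU : ∀ x, heatFlow (fun y => Real.exp (m * ψ y)) x t ≠ 0 :=
    fun x => (hψ.heatFlow_exp_pos hm.le x t).ne'
  refine ⟨_, _, fun x => ((hp x).log (hU x)).const_mul _,
    fun x => ((hq x).div (hp x) (hU x)).const_mul _, fun x =>
    (((hr x).log (hU x)).const_mul _).congr_deriv ?_⟩
  have := hU x
  have := hm.ne'
  field_simp
  ring

end ColeHopf

/-- Existence of solutions for positive piecewise constant order parameters, with regularity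
propagated by the Lipschitz constant. -/
theorem exists_solution_of_piecewise_const {φ b : ℝ → ℝ} {K : NNReal} (hφ : LipschitzWith K φ)
    {τ c : ℕ → ℝ} (hτ0 : τ 0 = 0) (hτ : StrictMono τ) (hc : ∀ k, 0 < c k)
    (hb : ∀ k, ∀ t ∈ Ioc (τ k) (τ (k + 1)), b t = c k) (n : ℕ) :
    ∃ F : ℝ → ℝ → ℝ, Continuous (fun p : ℝ × ℝ => F p.1 p.2) ∧ (∀ x, F x 0 = φ x) ∧
      (∀ t, LipschitzWith K fun x => F x t) ∧
      ∀ t ∈ Ioc 0 (τ n), ∃ p q : ℝ → ℝ, (∀ x, HasDerivAt (fun y => F y t) (p x) x) ∧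
        (∀ x, HasDerivAt p (q x) x) ∧
        ∀ x, HasDerivWithinAt (fun s => F x s) ((q x + b t * p x ^ 2) / 2) (Icc 0 t) t := by
  induction n with
  | zero =>
    exact ⟨fun x _ => φ x, hφ.continuous.comp continuous_fst, fun _ => rfl, fun _ => hφ, by
      simp [hτ0]⟩
  | succ n ih =>
    obtain ⟨F, hcont, hinit, hlip, hF⟩ := ih
    have hτn : 0 ≤ τ n := hτ0 ▸ hτ.monotone (Nat.zero_le n)
    -- The flow restarts at τ n from F(·, τ n), of which only the Lipschitz bound is needed.
    let G : ℝ → ℝ → ℝ := fun x t => coleHopf (c n) (fun y => F y (τ n)) x (t - τ n)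
    have hG : ∀ x t, t ≤ τ n → G x t = F x (τ n) := fun x t ht =>
      coleHopf_of_nonpos (hc n) _ x (sub_nonpos.2 ht)
    have hle : ∀ t, t ≤ τ n → (fun y => if t ≤ τ n then F y t else G y t) = fun y => F y t :=
      fun t ht => funext fun y => if_pos ht
    have hgt : ∀ t, τ n < t → (fun y => if t ≤ τ n then F y t else G y t) = fun y => G y t :=
      fun t ht => funext fun y => if_neg (not_le.2 ht)
    refine ⟨fun x t => if t ≤ τ n then F x t else G x t, ?_, fun x => ?_, fun t => ?_,
      fun t ht => ?_⟩
    · refine Continuous.if_le hcont ?_ continuous_snd continuous_const fun p hp => ?_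
      · exact ((hlip (τ n)).continuous_coleHopf (hc n)).comp
          (f := fun p : ℝ × ℝ => (p.1, p.2 - τ n)) (by fun_prop)
      · rw [hp, hG _ _ le_rfl]
    · simp only [if_pos hτn, hinit]
    · rcases le_or_gt t (τ n) with h | h
      · rw [hle t h]
        exact hlip t
      · rw [hgt t h]
        exact (hlip (τ n)).coleHopf (hc n) _
    · rcases le_or_gt t (τ n) with h | h
      -- At t = τ n the left derivative sees only the old piece, so the time derivatives need not
      -- match there.
      · obtain ⟨p, q, hp, hq, hr⟩ := hF t ⟨ht.1, h⟩
        refine ⟨p, q, ?_, hq, fun x => ?_⟩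
        · rwa [hle t h]
        · exact (hr x).congr (fun s hs => if_pos (hs.2.trans h)) (if_pos h)
      · obtain ⟨p, q, hp, hq, hr⟩ := (hlip (τ n)).coleHopf_equation (hc n) (sub_pos.2 h)
        refine ⟨p, q, ?_, hq, fun x => ?_⟩
        · rwa [hgt t h]
        · rw [hb n t ⟨h, ht.2⟩]
          have h1 : HasDerivAt (fun s => G x s) ((q x + c n * p x ^ 2) / 2) t :=
            (hr x).comp_sub_const t (τ n)
          refine (h1.congr_of_eventuallyEq ?_).hasDerivWithinAt
          filter_upwards [lt_mem_nhds h] with s hs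
          exact if_neg (not_le.2 hs)

theorem exists_isParisiPDESolution {φ b : ℝ → ℝ} {K : NNReal} (hφ : LipschitzWith K φ)
    {τ c : ℕ → ℝ} (hτ0 : τ 0 = 0) (hτ : StrictMono τ) (hc : ∀ k, 0 < c k)
    (hb : ∀ k, ∀ t ∈ Ioc (τ k) (τ (k + 1)), b t = c k) {n : ℕ} (hn : 1 ≤ τ n) :
    ∃ F, IsParisiPDESolution φ b F := by
  obtain ⟨F, hcont, hinit, hlip, hF⟩ := exists_solution_of_piecewise_const hφ hτ0 hτ hc hb n
  have hF' : ∀ t ∈ Ioc (0 : ℝ) 1, Differentiable ℝ (fun y => F y t) ∧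
      Differentiable ℝ (deriv fun y => F y t) ∧ ∀ x, HasDerivWithinAt (fun s => F x s)
      ((deriv (deriv (fun y => F y t)) x + b t * (deriv (fun y => F y t) x) ^ 2) / 2)
      (Icc 0 t) t := by
    intro t ht
    obtain ⟨p, q, hp, hq, hr⟩ := hF t ⟨ht.1, ht.2.trans hn⟩
    have h1 : (deriv fun y => F y t) = p := funext fun x => (hp x).deriv
    have h2 : deriv p = q := funext fun x => (hq x).deriv
    rw [h1, h2]
    exact ⟨fun x => (hp x).differentiableAt, fun x => (hq x).differentiableAt, hr⟩
  exact ⟨F, hcont.continuousOn, hinit, fun t ht => (hF' t ht).1, fun t ht => (hF' t ht).2.1,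
    ⟨K, fun t _ x => norm_deriv_le_of_lipschitz (hlip t)⟩, fun x t ht => (hF' t ht).2.2 x⟩

/-! ### Grid approximation of order parameters -/

/-- The right endpoint of the interval `(k/(n+1), (k+1)/(n+1)]` that contains `t`,
cut off at `1`. -/
noncomputable def gridCeil (n : ℕ) (t : ℝ) : ℝ := min (⌈(n + 1 : ℝ) * t⌉₊ / (n + 1 : ℝ)) 1

theorem gridCeil_mem (n : ℕ) (t : ℝ) : gridCeil n t ∈ Icc (0 : ℝ) 1 :=
  ⟨le_min (by positivity) zero_le_one, min_le_right _ _⟩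

theorem gridCeil_mono (n : ℕ) : Monotone (gridCeil n) := by
  intro s t hst
  unfold gridCeil
  gcongr

theorem abs_gridCeil_sub_le {n : ℕ} {t : ℝ} (ht : t ∈ Icc (0 : ℝ) 1) :
    |gridCeil n t - t| ≤ 1 / (n + 1 : ℝ) := by
  have hn : (0 : ℝ) < n + 1 := by positivity
  have h1 : t ≤ ⌈(n + 1 : ℝ) * t⌉₊ / (n + 1 : ℝ) := by
    rw [le_div_iff₀ hn, mul_comm]
    exact Nat.le_ceil _
  have h2 : ⌈(n + 1 : ℝ) * t⌉₊ / (n + 1 : ℝ) ≤ t + 1 / (n + 1 : ℝ) := by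
    rw [div_le_iff₀ hn, add_mul t, div_mul_cancel₀ _ hn.ne', mul_comm t]
    exact (Nat.ceil_lt_add_one (mul_nonneg hn.le ht.1)).le
  rw [gridCeil, abs_of_nonneg (sub_nonneg.2 (le_min h1 ht.2)), sub_le_iff_le_add']
  exact (min_le_left _ _).trans h2

theorem gridCeil_eq {n k : ℕ} {t : ℝ}
    (ht : t ∈ Ioc (k / (n + 1 : ℝ)) ((k + 1 : ℕ) / (n + 1 : ℝ))) :
    gridCeil n t = min ((k + 1 : ℕ) / (n + 1 : ℝ)) 1 := by
  have hn : (0 : ℝ) < n + 1 := by positivity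
  have : ⌈(n + 1 : ℝ) * t⌉₊ = k + 1 := by
    rw [Nat.ceil_eq_iff (Nat.succ_ne_zero k)]
    constructor
    · have := (div_lt_iff₀ hn).1 ht.1
      rw [Nat.succ_sub_one]
      linarith
    · have := (le_div_iff₀ hn).1 ht.2
      linarith
  rw [gridCeil, this]

theorem exists_grid_interval (n : ℕ) {t : ℝ} (ht : 0 < t) :
    ∃ k : ℕ, t ∈ Ioc (k / (n + 1 : ℝ)) ((k + 1 : ℕ) / (n + 1 : ℝ)) := by
  have hn : (0 : ℝ) < n + 1 := by positivity
  have hpos : 0 < ⌈(n + 1 : ℝ) * t⌉₊ := Nat.ceil_pos.2 (by positivity)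
  obtain ⟨k, hk⟩ := Nat.exists_eq_succ_of_ne_zero hpos.ne'
  have h := (Nat.ceil_eq_iff (Nat.succ_ne_zero k)).1 hk
  refine ⟨k, ?_, ?_⟩
  · rw [div_lt_iff₀ hn, mul_comm]
    simpa using h.1
  · rw [le_div_iff₀ hn, mul_comm]
    exact h.2

/-- Positive step approximations of an order parameter, which depend on it affinely. -/
noncomputable def stepApprox (a : ℝ → ℝ) (n : ℕ) (t : ℝ) : ℝ :=
  (1 - 1 / (n + 1 : ℝ)) * a (gridCeil n t) + 1 / (n + 1 : ℝ)

theorem one_sub_one_div_nonneg (n : ℕ) : 0 ≤ 1 - 1 / (n + 1 : ℝ) := by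
  rw [sub_nonneg, div_le_one (by positivity)]
  linarith [Nat.cast_nonneg (α := ℝ) n]

/-- The mixture of the approximations is exactly the approximation of the mixture, so the step
inequality applies for every n. -/
theorem stepApprox_add (a₁ a₂ : ℝ → ℝ) (α : ℝ) (n : ℕ) :
    stepApprox (fun t => α * a₁ t + (1 - α) * a₂ t) n =
      fun t => α * stepApprox a₁ n t + (1 - α) * stepApprox a₂ n t := by
  ext t
  simp only [stepApprox]
  ring

theorem stepApprox_le {a₁ a₂ : ℝ → ℝ} (ha : ∀ t ∈ Icc (0 : ℝ) 1, a₁ t ≤ a₂ t) (n : ℕ) (t : ℝ) :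
    stepApprox a₁ n t ≤ stepApprox a₂ n t :=
  add_le_add_left (mul_le_mul_of_nonneg_left (ha _ (gridCeil_mem n t))
    (one_sub_one_div_nonneg n)) _

namespace IsOrderParameter

variable {a b : ℝ → ℝ}

theorem isStepOrderParameter_stepApprox (ha : IsOrderParameter a) (n : ℕ) :
    IsStepOrderParameter (stepApprox a n) where
  mapsTo t _ := by
    have h := ha.mapsTo (gridCeil_mem n t)
    have h0 := one_sub_one_div_nonneg n
    have h1 : 0 < 1 / (n + 1 : ℝ) := by positivity
    have h2 := mul_le_mul_of_nonneg_left h.2 h0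
    have h3 := mul_nonneg h0 h.1
    constructor <;> simp only [stepApprox] <;> linarith
  antitoneOn s _ t _ hst :=
    add_le_add_left (mul_le_mul_of_nonneg_left (ha.antitoneOn (gridCeil_mem n s)
      (gridCeil_mem n t) (gridCeil_mono n hst)) (one_sub_one_div_nonneg n)) _
  left_continuous t ht := by
    rcases ht.1.eq_or_lt with h | h
    · subst h
      rw [Icc_self]
      exact continuousWithinAt_singleton
    · obtain ⟨k, hk⟩ := exists_grid_interval n h
      refine (continuousWithinAt_const (b := stepApprox a n t)).congr_of_eventuallyEq ?_ rfl
      filter_upwards [self_mem_nhdsWithin, mem_nhdsWithin_of_mem_nhds (lt_mem_nhds hk.1)]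
        with s hs hs'
      rw [stepApprox, stepApprox, gridCeil_eq hk, gridCeil_eq ⟨hs', hs.2.trans hk.2⟩]
  finite_image := by
    refine ((Set.finite_Iic (n + 1)).image fun k : ℕ =>
      (1 - 1 / (n + 1 : ℝ)) * a (min (k / (n + 1 : ℝ)) 1) + 1 / (n + 1 : ℝ)).subset ?_
    rintro _ ⟨t, ht, rfl⟩
    refine ⟨⌈(n + 1 : ℝ) * t⌉₊, ?_, rfl⟩
    rw [mem_Iic, Nat.ceil_le]
    push_cast
    exact mul_le_of_le_one_right (by positivity) ht.2

theorem exists_solution_stepApprox {φ : ℝ → ℝ} {K : NNReal} (hφ : LipschitzWith K φ)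
    (ha : IsOrderParameter a) (n : ℕ) : ∃ F, IsParisiPDESolution φ (stepApprox a n) F := by
  have hn : (0 : ℝ) < n + 1 := by positivity
  refine exists_isParisiPDESolution hφ (τ := fun k => k / (n + 1 : ℝ)) (n := n + 1)
    (c := fun k => (1 - 1 / (n + 1 : ℝ)) * a (min ((k + 1 : ℕ) / (n + 1 : ℝ)) 1) + 1 / (n + 1 : ℝ))
    (by simp) (fun i j hij => by
      have : (i : ℝ) < j := by exact_mod_cast hij
      simp only
      gcongr) (fun k => ?_)
    (fun k t ht => by rw [stepApprox, gridCeil_eq ht]) ?_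
  · have h := ha.mapsTo (show min (((k + 1 : ℕ) : ℝ) / (n + 1 : ℝ)) 1 ∈ Icc (0 : ℝ) 1 from
      ⟨le_min (by positivity) zero_le_one, min_le_right _ _⟩)
    have h1 : 0 < 1 / (n + 1 : ℝ) := by positivity
    exact add_pos_of_nonneg_of_pos (mul_nonneg (one_sub_one_div_nonneg n) h.1) h1
  · simp only [Nat.cast_add, Nat.cast_one, div_self hn.ne', le_refl]

theorem intervalIntegrable_abs_sub (ha : IsOrderParameter a) (hb : IsOrderParameter b) :
    IntervalIntegrable (fun t => |a t - b t|) MeasureTheory.volume 0 1 :=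
  (ha.intervalIntegrable.sub hb.intervalIntegrable).abs

/-- Grid points approach t from the right, so left-continuity does not suffice; but a monotone
function has only countably many discontinuities, and dominated convergence applies. -/
theorem tendsto_stepApprox (ha : IsOrderParameter a) :
    Tendsto (fun n => ∫ t in (0 : ℝ)..1, |stepApprox a n t - a t|) atTop (𝓝 0) := by
  have hcount := ha.antitoneOn.countable_not_continuousWithinAt
  have h0 : ∫ t in (0 : ℝ)..1, (0 : ℝ) = 0 := by simp
  suffices h : Tendsto (fun n => ∫ t in (0 : ℝ)..1, |stepApprox a n t - a t|) atTop
      (𝓝 (∫ t in (0 : ℝ)..1, (0 : ℝ))) by rwa [h0] at h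
  refine intervalIntegral.tendsto_integral_filter_of_dominated_convergence (fun _ => 1)
    (Eventually.of_forall fun n => ?_) (Eventually.of_forall fun n => ?_)
    intervalIntegrable_const ?_
  · rw [uIoc_of_le zero_le_one]
    exact ((ha.isStepOrderParameter_stepApprox n).intervalIntegrable_abs_sub
      ha).aestronglyMeasurable
  · refine MeasureTheory.ae_of_all _ fun t ht => ?_
    rw [uIoc_of_le zero_le_one] at ht
    have ht' : t ∈ Icc (0 : ℝ) 1 := ⟨ht.1.le, ht.2⟩
    have h1 := (ha.isStepOrderParameter_stepApprox n).mapsTo ht'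
    have h2 := ha.mapsTo ht'
    rw [Real.norm_eq_abs, abs_abs, abs_le]
    constructor <;> linarith [h1.1, h1.2, h2.1, h2.2]
  · filter_upwards [hcount.ae_notMem MeasureTheory.volume] with t ht ht'
    rw [uIoc_of_le zero_le_one] at ht'
    have ht1 : t ∈ Icc (0 : ℝ) 1 := ⟨ht'.1.le, ht'.2⟩
    have hcw : ContinuousWithinAt a (Icc 0 1) t := by
      by_contra h
      exact ht ⟨ht1, h⟩
    have hε : Tendsto (fun n : ℕ => 1 / (n + 1 : ℝ)) atTop (𝓝 0) :=
      tendsto_one_div_add_atTop_nhds_zero_nat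
    have hgrid : Tendsto (fun n => gridCeil n t) atTop (𝓝[Icc 0 1] t) := by
      refine tendsto_nhdsWithin_iff.2 ⟨?_, Eventually.of_forall fun n => gridCeil_mem n t⟩
      rw [tendsto_iff_dist_tendsto_zero]
      exact squeeze_zero (fun n => dist_nonneg) (fun n => abs_gridCeil_sub_le ht1) hε
    have h := (((hε.const_sub 1).mul (hcw.tendsto.comp hgrid)).add hε).sub_const (a t)
    have h' := h.abs
    simpa [stepApprox] using h'

end IsOrderParameter

/-! ### Well-definedness of the Parisi functional -/

namespace IsStepApproximation

variable {φ a : ℝ → ℝ} {b b' : ℕ → ℝ → ℝ} {G G' : ℕ → ℝ → ℝ → ℝ} {K : NNReal}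

/-- Used with one approximation it gives the Cauchy property, with two the independence of the
limit. -/
theorem abs_sub_le (hφ : LipschitzWith K φ) (ha : IsOrderParameter a)
    (h : IsStepApproximation φ a b G) (h' : IsStepApproximation φ a b' G') (x : ℝ) (n m : ℕ) :
    |G n x 1 - G' m x 1| ≤ K ^ 2 / 2 *
      ((∫ t in (0 : ℝ)..1, |b n t - a t|) + ∫ t in (0 : ℝ)..1, |b' m t - a t|) := by
  have hb := (h.step n).toIsOrderParameter
  have hb' := (h'.step m).toIsOrderParameter
  refine ((h.solution n).abs_sub_le_integral hφ hb hb' (h'.solution m)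
    (right_mem_Icc.2 zero_le_one)).trans ?_
  gcongr
  rw [← intervalIntegral.integral_add (hb.intervalIntegrable_abs_sub ha)
    (hb'.intervalIntegrable_abs_sub ha)]
  refine intervalIntegral.integral_mono_on zero_le_one (hb.intervalIntegrable_abs_sub hb')
    ((hb.intervalIntegrable_abs_sub ha).add (hb'.intervalIntegrable_abs_sub ha)) fun t _ => ?_
  rw [abs_sub_comm (b' m t)]
  exact _root_.abs_sub_le _ _ _

theorem exists_tendsto (hφ : LipschitzWith K φ) (ha : IsOrderParameter a)
    (h : IsStepApproximation φ a b G) (x : ℝ) :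
    ∃ v, Tendsto (fun n => G n x 1) atTop (𝓝 v) := by
  refine cauchySeq_tendsto_of_complete (cauchySeq_iff_tendsto_dist_atTop_0.2 ?_)
  have h1 := h.tendsto.comp (tendsto_fst (α := ℕ) (β := ℕ) (f := atTop) (g := atTop))
  have h2 := h.tendsto.comp (tendsto_snd (α := ℕ) (β := ℕ) (f := atTop) (g := atTop))
  have h3 := (h1.add h2).const_mul ((K : ℝ) ^ 2 / 2)
  rw [add_zero, mul_zero, prod_atTop_atTop_eq] at h3
  exact squeeze_zero (fun _ => dist_nonneg) (fun p => abs_sub_le hφ ha h h x p.1 p.2) h3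

theorem tendsto_of_tendsto (hφ : LipschitzWith K φ) (ha : IsOrderParameter a)
    (h : IsStepApproximation φ a b G) (h' : IsStepApproximation φ a b' G') {x v : ℝ}
    (hv : Tendsto (fun n => G n x 1) atTop (𝓝 v)) :
    Tendsto (fun n => G' n x 1) atTop (𝓝 v) := by
  have h3 := (h.tendsto.add h'.tendsto).const_mul ((K : ℝ) ^ 2 / 2)
  rw [add_zero, mul_zero] at h3
  exact tendsto_of_tendsto_of_dist hv
    (squeeze_zero (fun _ => dist_nonneg) (fun n => abs_sub_le hφ ha h h' x n n) h3)

end IsStepApproximation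

theorem isStepApproximation_stepApprox {φ a : ℝ → ℝ} (ha : IsOrderParameter a)
    {G : ℕ → ℝ → ℝ → ℝ} (hG : ∀ n, IsParisiPDESolution φ (stepApprox a n) (G n)) :
    IsStepApproximation φ a (stepApprox a) G :=
  ⟨ha.isStepOrderParameter_stepApprox, ha.tendsto_stepApprox, hG⟩

theorem LipschitzWith.parisiFunctionalDefined {φ a : ℝ → ℝ} {K : NNReal}
    (hφ : LipschitzWith K φ) (ha : IsOrderParameter a) (x : ℝ) :
    ParisiFunctionalDefined φ x a := by
  choose G hG using ha.exists_solution_stepApprox hφ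
  have h := isStepApproximation_stepApprox ha hG
  obtain ⟨v, hv⟩ := h.exists_tendsto hφ ha x
  exact Classical.epsilon_spec (p := IsParisiSolutionValue φ a x 1)
    ⟨v, ⟨_, _, h⟩, fun b G' h' => h.tendsto_of_tendsto hφ ha h' hv⟩

/-! ### Convexity inequality in the limit -/

theorem IsOrderParameter.convex_combination {a₁ a₂ : ℝ → ℝ} (ha₁ : IsOrderParameter a₁)
    (ha₂ : IsOrderParameter a₂) {α : ℝ} (hα : α ∈ Icc (0 : ℝ) 1) :
    IsOrderParameter fun t => α * a₁ t + (1 - α) * a₂ t where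
  mapsTo t ht := convex_Icc (0 : ℝ) 1 (ha₁.mapsTo ht) (ha₂.mapsTo ht) hα.1
    (sub_nonneg.2 hα.2) (by ring)
  antitoneOn s hs t ht hst := add_le_add
    (mul_le_mul_of_nonneg_left (ha₁.antitoneOn hs ht hst) hα.1)
    (mul_le_mul_of_nonneg_left (ha₂.antitoneOn hs ht hst) (sub_nonneg.2 hα.2))
  left_continuous t ht := ((ha₁.left_continuous t ht).const_mul α).add
    ((ha₂.left_continuous t ht).const_mul (1 - α))

theorem exists_lipschitzWith_of_mem_orderedPairs {φ₁ φ₂ : ℝ → ℝ}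
    (hφ : (φ₁, φ₂) ∈ orderedPairs) :
    (∃ K, LipschitzWith K φ₁) ∧ ∃ K, LipschitzWith K φ₂ := by
  rcases hφ with h | h <;>
    exact ⟨IsAdmissible.exists_lipschitzWith h.1, IsAdmissible.exists_lipschitzWith h.2.1⟩

theorem theorem1 (φ₁ φ₂ : ℝ → ℝ) (hφ : (φ₁, φ₂) ∈ orderedPairs)
    (a₁ a₂ : ℝ → ℝ) (ha₁ : IsOrderParameter a₁) (ha₂ : IsOrderParameter a₂)
    (ha : ∀ t ∈ Set.Icc (0 : ℝ) 1, a₁ t ≤ a₂ t)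
    (α : ℝ) (hα : α ∈ Set.Icc (0 : ℝ) 1) (x : ℝ) :
    ParisiFunctionalDefined φ₁ x a₁ ∧ ParisiFunctionalDefined φ₂ x a₂ ∧
    ParisiFunctionalDefined (fun y => α * φ₁ y + (1 - α) * φ₂ y) x
      (fun t => α * a₁ t + (1 - α) * a₂ t) ∧
    parisiFunctional (fun y => α * φ₁ y + (1 - α) * φ₂ y) x
        (fun t => α * a₁ t + (1 - α) * a₂ t) ≤
      α * parisiFunctional φ₁ x a₁ + (1 - α) * parisiFunctional φ₂ x a₂ := by
  obtain ⟨⟨K₁, hφ₁⟩, K₂, hφ₂⟩ := exists_lipschitzWith_of_mem_orderedPairs hφ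
  have hφ' : LipschitzWith (‖α‖₊ * K₁ + ‖1 - α‖₊ * K₂) fun y => α * φ₁ y + (1 - α) * φ₂ y :=
    ((lipschitzWith_smul α).comp hφ₁).add ((lipschitzWith_smul (1 - α)).comp hφ₂)
  have ha' := ha₁.convex_combination ha₂ hα
  have hP₁ := hφ₁.parisiFunctionalDefined ha₁ x
  have hP₂ := hφ₂.parisiFunctionalDefined ha₂ x
  have hP := hφ'.parisiFunctionalDefined ha' x
  refine ⟨hP₁, hP₂, hP, ?_⟩
  choose G₁ hG₁ using ha₁.exists_solution_stepApprox hφ₁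
  choose G₂ hG₂ using ha₂.exists_solution_stepApprox hφ₂
  choose G hG using ha'.exists_solution_stepApprox hφ'
  -- Each value is the limit along its own grid approximations, and the inequality holds at every
  -- stage n.
  refine le_of_tendsto_of_tendsto' (hP.2 _ _ (isStepApproximation_stepApprox ha' hG))
    (((hP₁.2 _ _ (isStepApproximation_stepApprox ha₁ hG₁)).const_mul α).add
      ((hP₂.2 _ _ (isStepApproximation_stepApprox ha₂ hG₂)).const_mul (1 - α))) fun n => ?_
  exact IsParisiPDESolution.le_convex_combination hφ₁ hφ₂ hφ
    (ha₁.isStepOrderParameter_stepApprox n).toIsOrderParameter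
    (ha₂.isStepOrderParameter_stepApprox n).toIsOrderParameter
    (fun t _ => stepApprox_le ha n t) (hG₁ n) (hG₂ n) hα hφ'
    (stepApprox_add a₁ a₂ α n ▸ hG n) (right_mem_Icc.2 zero_le_one) x
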